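/- Fix a signature $\mathcal F$, an infinite set of variables $\mathcal V$, and a set $\mathcal B$ of equations between terms over $\mathcal F,\mathcal V$ such that $\mathrm{Var}(\ell)=\mathrm{Var}(r)$ for all $\ell\approx r\in\mathcal B$. Let $\mathcal B^{\pm}=\mathcal B\cup\{r\approx\ell\mid \ell\approx r\in\mathcal B\}$. For a set $\mathcal S$ of pairs of terms, $\to_{\mathcal S}$ is its rewrite relation (closure under contexts and substitutions), $\leftrightarrow_{\mathcal S}$ the symmetric closure and $\leftrightarrow^*_{\mathcal S}$ the conversion; write $\sim$ for $\leftrightarrow^*_{\mathcal B}$. Put $\downarrow^{\sim}_{\mathcal R}\;=\;\to^*_{\mathcal R}\cdot\sim\cdot\;{}^*_{\mathcal R}\!\leftarrow$. Let $>$ be a $\mathcal B$-compatible reduction order: a well-founded strict order on terms, closed under contexts and substitutions, with ${\sim\cdot>\cdot\sim}\subseteq{>}$. The inference system $\mathcal I_B$ transforms pairs of an equational system $\mathcal E$ and a rewrite system $\mathcal R$ by the following rules, where $\uplus$ is disjoint union and $s\mathrel{\dot\approx}t$ stands for $s\approx t$ or $t\approx s$: - deduce: $(\mathcal E,\mathcal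 R)\vdash(\mathcal E\cup\{s\approx t\},\mathcal R)$ if $s\;{}_{\mathcal R}\!\leftarrow\cdot\to_{\mathcal R\cup\mathcal B^{\pm}}t$; - orient: $(\mathcal E\uplus\{s\mathrel{\dot\approx}t\},\mathcal R)\vdash(\mathcal E,\mathcal R\cup\{s\to t\})$ if $s>t$; - delete: $(\mathcal E\uplus\{s\approx t\},\mathcal R)\vdash(\mathcal E,\mathcal R)$ if $s\sim t$; - simplify: $(\mathcal E\uplus\{s\mathrel{\dot\approx}t\},\mathcal R)\vdash(\mathcal E\cup\{u\approx t\},\mathcal R)$ if $s\to_{\mathcal R}u$; - collapse: $(\mathcal E,\mathcal R\uplus\{s\to t\})\vdash(\mathcal E\cup\{u\approx t\},\mathcal R)$ if $s\to_{\mathcal R}u$; - compose: $(\mathcal E,\mathcal R\uplus\{s\to t\})\vdash(\mathcal E,\mathcal R\cup\{s\to u\})$ if $t\to_{\mathcal R}u$. For sets $\mathcal R_1,\mathcal R_2$ of pairs of terms, a critical peak consists of a source $\ell_2\sigma$, a position $p$ and the two terms $\ell_2\sigma[r_1\sigma]_p$ and $r_2\sigma$, where $(\ell_1,r_1)$ and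 $(\ell_2,r_2)$ are variants without common variables of pairs in $\mathcal R_1$ and $\mathcal R_2$, $p$ is a function-symbol position of $\ell_2$, $\sigma$ is a most general unifier of $\ell_1$ and $\ell_2|_p$, and the two pairs are not variants of each other if $p$ is the root; its critical pair is $\ell_2\sigma[r_1\sigma]_p\approx r_2\sigma$. It is prime with respect to $\mathcal R$ if all proper subterms of $\ell_2\sigma|_p$ are $\to_{\mathcal R}$-normal forms. Let $\mathrm{PCP}(\mathcal R)$ be the set of critical pairs of peaks that are prime with respect to $\mathcal R$ with $\mathcal R_1=\mathcal R_2=\mathcal R$, and let $\mathrm{PCP}^{\pm}(\mathcal R,\mathcal B^{\pm})$ be the set of critical pairs of peaks that are prime with respect to $\mathcal R$ with $(\mathcal R_1,\mathcal R_2)=(\mathcal R,\mathcal B^{\pm})$ or $(\mathcal R_1,\mathcal R_2)=(\mathcal B^{\pm},\mathcal R)$. A run for an equational system $\mathcal E$ is a finite sequence $(\mathcal E_0,\mathcal R_0)\vdash\cdots\vdash(\mathcal E_n,\mathcal R_n)$ of steps of $\mathcal I_B$ with $\mathcal E_0=\mathcal E$ and $\mathcal R_0=\varnothing$. It is non-failing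 if $\mathcal E_n=\varnothing$. It is fair if every left-hand side of $\mathcal R_n$ is linear and $$\mathrm{PCP}(\mathcal R_n)\cup\mathrm{PCP}^{\pm}(\mathcal R_n,\mathcal B^{\pm})\;\subseteq\;{\downarrow^{\sim}_{\mathcal R_n}}\cup\bigcup_{i=0}^{n}{\leftrightarrow_{\mathcal E_i}}.$$ **Corollary.** For every fair and non-failing run for $\mathcal E$ in $\mathcal I_B$, the system $\mathcal R_n$ is a $\mathcal B$-complete presentation of $\mathcal E$. That is, $\mathcal R_n$ is a term rewrite system (no left-hand side is a variable, and every variable of a right-hand side occurs in the left-hand side); there is no infinite sequence of $\sim\cdot\to_{\mathcal R_n}\cdot\sim$ steps; every conversion modulo $\mathcal B$ is a valley, $({\to_{\mathcal R_n}}\cup{{}_{\mathcal R_n}\!\leftarrow}\cup{\sim})^*\subseteq{\downarrow^{\sim}_{\mathcal R_n}}$; and $\mathcal R_n$ represents $\mathcal E$ modulo $\mathcal B$, ${\leftrightarrow^*_{\mathcal E\cup\mathcal B}}={\leftrightarrow^*_{\mathcal R_n\cup\mathcal B}}$. -/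

import Mathlib

universe u v w

namespace RewritingModulo

/-! Terms over the function symbols of `L` with variables from `V` are Mathlib's `L.Term V`
(the relation symbols of `L` play no role); the application of a substitution `σ : V → L.Term V`
is Mathlib's `Term.subst`. A pair of terms `(s, t)` serves both as the equation `s ≈ t` and as
the rule `s → t`. -/

section Terms

variable {L : FirstOrder.Language.{u, v}} {V : Type w}

/-- The subterm of a term at a position (a list of argument indices, counted from `0`);
`none` if the list is not a position of the term. -/
def subtermAt : L.Term V → List ℕ → Option (L.Term V)
  | t, [] => some t
  | .var _, _ :: _ => none
  | .func (l := l) _ ts, i :: p => if h : i < l then subtermAt (ts ⟨i, h⟩) p else none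

/-- `p` is a position of `t`. -/
def IsPos (t : L.Term V) (p : List ℕ) : Prop := ∃ s, subtermAt t p = some s

/-- The term `t[u]_p`, obtained by replacing the subterm of `t` at position `p` by `u`
(only used if `p` is a position of `t`; otherwise the value is `t` with no replacement). -/
def replaceAt : L.Term V → List ℕ → L.Term V → L.Term V
  | _, [], u => u
  | .var x, _ :: _, _ => .var x
  | .func f ts, i :: p, u => .func f fun j => if (j : ℕ) = i then replaceAt (ts j) p u else ts j

/-- The set of variables of a term. -/
def vars (t : L.Term V) : Set V := {x | ∃ p, subtermAt t p = some (.var x)}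

/-- A term is linear if no variable occurs more than once. -/
def IsLinear (t : L.Term V) : Prop :=
  ∀ (x : V) (p q : List ℕ),
    subtermAt t p = some (.var x) → subtermAt t q = some (.var x) → p = q

/-- Term rewrite systems: left-hand sides are not variables, and all variables of a right-hand
side occur in the left-hand side. -/
def IsTRS (R : Set (L.Term V × L.Term V)) : Prop :=
  ∀ ρ ∈ R, (∀ x, ρ.1 ≠ .var x) ∧ vars ρ.2 ⊆ vars ρ.1

/-- All left-hand sides are linear. -/
def IsLeftLinear (R : Set (L.Term V × L.Term V)) : Prop := ∀ ρ ∈ R, IsLinear ρ.1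

/-- `ρ'` is a variant of `ρ`: it is obtained from `ρ` by a bijective renaming of variables. -/
def IsVariant (ρ ρ' : L.Term V × L.Term V) : Prop :=
  ∃ π : Equiv.Perm V,
    ρ.1.subst (fun x => .var (π x)) = ρ'.1 ∧ ρ.2.subst (fun x => .var (π x)) = ρ'.2

/-! ### Rewriting -/

/-- The rewrite relation of a set of pairs of terms. -/
def Step (E : Set (L.Term V × L.Term V)) (s t : L.Term V) : Prop :=
  ∃ ρ ∈ E, ∃ (p : List ℕ) (σ : V → L.Term V),
    subtermAt s p = some (ρ.1.subst σ) ∧ t = replaceAt s p (ρ.2.subst σ)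

/-- The symmetric closure of the rewrite relation. -/
def SymmStep (E : Set (L.Term V × L.Term V)) (s t : L.Term V) : Prop := Step E s t ∨ Step E t s

/-- The reflexive transitive closure of the rewrite relation. -/
def Steps (E : Set (L.Term V × L.Term V)) : L.Term V → L.Term V → Prop :=
  Relation.ReflTransGen (Step E)

/-- Conversion: the equational theory induced by a set of pairs of terms. -/
def Conv (E : Set (L.Term V × L.Term V)) : L.Term V → L.Term V → Prop :=
  Relation.ReflTransGen (SymmStep E)

/-- Normal forms. -/
def IsNF (R : Set (L.Term V × L.Term V)) (s : L.Term V) : Prop := ∀ t, ¬ Step R s t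

/-- `B^±`: the equations of `B` in both directions. -/
def symmetrize (B : Set (L.Term V × L.Term V)) : Set (L.Term V × L.Term V) :=
  B ∪ {e | (e.2, e.1) ∈ B}

/-- Rewriting modulo `B`. -/
def StepMod (R B : Set (L.Term V × L.Term V)) (s t : L.Term V) : Prop :=
  ∃ s' t', Conv B s s' ∧ Step R s' t' ∧ Conv B t' t

/-- The valley relation modulo `B`, in which rewriting is ordinary rewriting with `R`. -/
def JoinableMod (R B : Set (L.Term V × L.Term V)) (s t : L.Term V) : Prop :=
  ∃ s' t', Steps R s s' ∧ Conv B s' t' ∧ Steps R t t'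

/-- There is no infinite sequence of rewrite steps modulo `B`. -/
def TerminatingMod (R B : Set (L.Term V × L.Term V)) : Prop :=
  ¬ ∃ f : ℕ → L.Term V, ∀ i, StepMod R B (f i) (f (i + 1))

/-- Conversions with `R` modulo `B` are contained in the valley relation modulo `B`. -/
def ChurchRosserMod (R B : Set (L.Term V × L.Term V)) : Prop :=
  ∀ s t, Relation.ReflTransGen (fun a b => Step R a b ∨ Step R b a ∨ Conv B a b) s t →
    JoinableMod R B s t

/-- `R` is a `B`-complete presentation of `E`. -/
structure IsCompletePresentation (B E R : Set (L.Term V × L.Term V)) : Prop where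
  isTRS : IsTRS R
  terminating : TerminatingMod R B
  churchRosser : ChurchRosserMod R B
  represents : ∀ s t, Conv (E ∪ B) s t ↔ Conv (R ∪ B) s t

/-- `B`-compatible reduction orders: well-founded strict orders on terms that are closed under
contexts and substitutions and absorb `B`-conversion on both sides. -/
structure IsReductionOrder (B : Set (L.Term V × L.Term V)) (gt : L.Term V → L.Term V → Prop) :
    Prop where
  trans : ∀ s t u, gt s t → gt t u → gt s u
  wf : WellFounded fun s t => gt t s
  context : ∀ s t, gt s t → ∀ c p, IsPos c p → gt (replaceAt c p s) (replaceAt c p t)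
  subst : ∀ s t, gt s t → ∀ σ : V → L.Term V, gt (s.subst σ) (t.subst σ)
  compatible : ∀ s s' t' t, Conv B s s' → gt s' t' → Conv B t' t → gt s t

/-! ### Prime critical pairs -/

/-- `σ` is a most general unifier of `s` and `t`. -/
def IsMGU (σ : V → L.Term V) (s t : L.Term V) : Prop :=
  s.subst σ = t.subst σ ∧
    ∀ τ : V → L.Term V, s.subst τ = t.subst τ → ∃ δ : V → L.Term V, ∀ x, τ x = (σ x).subst δ

/-- `t ←[p] s →[ε] u` is a critical peak, obtained from an overlap of a variant `ρ₁` of a rule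
of `R₁` into a variant `ρ₂` of a rule of `R₂` at the function position `p` of the left-hand side
of `ρ₂`. -/
def IsCriticalPeak (R₁ R₂ : Set (L.Term V × L.Term V))
    (t : L.Term V) (p : List ℕ) (s u : L.Term V) : Prop :=
  ∃ (ρ₁ ρ₂ : L.Term V × L.Term V) (m : L.Term V) (σ : V → L.Term V),
    (∃ ρ ∈ R₁, IsVariant ρ ρ₁) ∧ (∃ ρ ∈ R₂, IsVariant ρ ρ₂) ∧
    Disjoint (vars ρ₁.1 ∪ vars ρ₁.2) (vars ρ₂.1 ∪ vars ρ₂.2) ∧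
    subtermAt ρ₂.1 p = some m ∧ (∀ x, m ≠ .var x) ∧
    IsMGU σ ρ₁.1 m ∧
    (p = [] → ¬ IsVariant ρ₁ ρ₂) ∧
    t = replaceAt (ρ₂.1.subst σ) p (ρ₁.2.subst σ) ∧ s = ρ₂.1.subst σ ∧ u = ρ₂.2.subst σ

/-- The critical pairs between `R₁` and `R₂` whose critical peaks `t ←[p] s →[ε] u` are prime
with respect to `R`: all proper subterms of `s|_p` are normal forms of `R`. -/
def primeCriticalPairs (R R₁ R₂ : Set (L.Term V × L.Term V)) : Set (L.Term V × L.Term V) :=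
  {e | ∃ (p : List ℕ) (s : L.Term V), IsCriticalPeak R₁ R₂ e.1 p s e.2 ∧
    ∀ m, subtermAt s p = some m →
      ∀ (q : List ℕ) (m' : L.Term V), q ≠ [] → subtermAt m q = some m' → IsNF R m'}

/-- `PCP(R)`. -/
def PCP (R : Set (L.Term V × L.Term V)) : Set (L.Term V × L.Term V) := primeCriticalPairs R R R

/-- `PCP^±(R, B^±)`; primality is always with respect to `R`. -/
def PCPpm (R B : Set (L.Term V × L.Term V)) : Set (L.Term V × L.Term V) :=
  primeCriticalPairs R R (symmetrize B) ∪ primeCriticalPairs R (symmetrize B) R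

/-! ### The inference system -/

/-- `StepB B gt E R E' R'` is an inference step from `(E, R)` to `(E', R')`. In the rules that
remove an equation or a rule, `E` and `R` denote what remains (the union with the removed
element is disjoint), and rewriting in the side conditions uses what remains. -/
inductive StepB (B : Set (L.Term V × L.Term V)) (gt : L.Term V → L.Term V → Prop) :
    Set (L.Term V × L.Term V) → Set (L.Term V × L.Term V) →
    Set (L.Term V × L.Term V) → Set (L.Term V × L.Term V) → Prop
  | deduce (E R : Set (L.Term V × L.Term V)) (s m t : L.Term V) :
      Step R m s → Step (R ∪ symmetrize B) m t →
      StepB B gt E R (E ∪ {(s, t)}) R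
  | orient (E R : Set (L.Term V × L.Term V)) (s t : L.Term V) (e : L.Term V × L.Term V) :
      e = (s, t) ∨ e = (t, s) → e ∉ E → gt s t →
      StepB B gt (E ∪ {e}) R E (R ∪ {(s, t)})
  | delete (E R : Set (L.Term V × L.Term V)) (s t : L.Term V) :
      (s, t) ∉ E → Conv B s t →
      StepB B gt (E ∪ {(s, t)}) R E R
  | simplify (E R : Set (L.Term V × L.Term V)) (s t t' : L.Term V) (e : L.Term V × L.Term V) :
      e = (s, t) ∨ e = (t, s) → e ∉ E → Step R s t' →
      StepB B gt (E ∪ {e}) R (E ∪ {(t', t)}) R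
  | collapse (E R : Set (L.Term V × L.Term V)) (s t t' : L.Term V) :
      (s, t) ∉ R → Step R s t' →
      StepB B gt E (R ∪ {(s, t)}) (E ∪ {(t', t)}) R
  | compose (E R : Set (L.Term V × L.Term V)) (s t t' : L.Term V) :
      (s, t) ∉ R → Step R t t' →
      StepB B gt E (R ∪ {(s, t)}) E (R ∪ {(s, t')})

/-- `(Es 0, Rs 0), …, (Es n, Rs n)` is a run for `E`; values beyond `n` are irrelevant. -/
structure IsRun (B : Set (L.Term V × L.Term V)) (gt : L.Term V → L.Term V → Prop)
    (E : Set (L.Term V × L.Term V)) (n : ℕ) (Es Rs : ℕ → Set (L.Term V × L.Term V)) :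
    Prop where
  init_E : Es 0 = E
  init_R : Rs 0 = ∅
  step : ∀ i < n, StepB B gt (Es i) (Rs i) (Es (i + 1)) (Rs (i + 1))

/-- Fairness of a run of length `n`. -/
structure IsFair (B : Set (L.Term V × L.Term V)) (n : ℕ)
    (Es Rs : ℕ → Set (L.Term V × L.Term V)) : Prop where
  leftLinear : IsLeftLinear (Rs n)
  fair : ∀ e ∈ PCP (Rs n) ∪ PCPpm (Rs n) B,
    JoinableMod (Rs n) B e.1 e.2 ∨ ∃ i ≤ n, SymmStep (Es i) e.1 e.2

end Terms

end RewritingModulo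

/-!
The order `>` contains every rule that occurs in the run, so the final system `R` is a term
rewrite system (a rule with a variable left-hand side or an extra variable on the right would give
a term smaller than one of its own subterms) and rewriting modulo `B` terminates. Each inference
step only replaces equations and rules by consequences, and conversely each discarded equation or
rule is simulated by what remains; hence the equational theory modulo `B` is preserved.

The Church–Rosser property rests on the local analysis of peaks `s ← w → t` and cliffs
`s ← w ∼ t` (`exists_linked_of_peak`): there is a further reduct `v` of `w` such that both
`s`, `v` and `v`, `t` are joinable modulo `B` or instances of prime critical pairs. For an overlap
that is not prime, `v` contracts an innermost redex strictly below the inner redex; overlaps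
with that redex are prime. Variable overlaps are joinable, where left-linearity is what lets a
`B`-step below a rule be postponed. Critical peaks require most general unifiers, which are
obtained in `exists_isMGU` from the least decomposition-closed equivalence that identifies the two
terms: a given unifier serves as the recursion measure that resolves its classes.

By fairness a prime critical pair that is not joinable is a step of some intermediate set of
equations. The simulation of steps never leaves a set of terms that is closed under `>` and `∼`
(`StepB.convIn`). Applied to the terms smaller than `w`, this turns a peak at `w` into a conversion
below `w`. In a cliff, `t` is not smaller than `w`, but an equation between `t` and a term below
`w` can only be transformed by rewriting `t` or the smaller term, so that in the end it becomes a
rewrite step from `t` followed by a conversion below `w` (`StepB.descends`). Therefore a cliff can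
be extended by a step `t → u` such that `s` and `u` are convertible below `w`
(`IsFair.resolvesLocally`). Well-founded induction then shows that `B`-equivalent terms have
`B`-equivalent normal forms (`ResolvesLocally.uniqueNFMod`), and the Church–Rosser property modulo
`B` follows by passing to normal forms along a conversion.
-/

namespace RewritingModulo

open FirstOrder.Language Relation

variable {L : FirstOrder.Language.{u, v}} {V : Type w}

/-! ### Positions, replacement and substitution -/

@[simp] lemma subtermAt_nil (t : L.Term V) : subtermAt t [] = some t := by
  cases t <;> rfl

@[simp] lemma replaceAt_nil (t u : L.Term V) : replaceAt t [] u = u := by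
  cases t <;> rfl

@[simp] lemma subtermAt_var_cons (x : V) (i : ℕ) (p : List ℕ) :
    subtermAt (.var x : L.Term V) (i :: p) = none := rfl

lemma subtermAt_func_cons {l : ℕ} (f : L.Functions l) (ts : Fin l → L.Term V) (i : ℕ)
    (p : List ℕ) :
    subtermAt (.func f ts) (i :: p) = if h : i < l then subtermAt (ts ⟨i, h⟩) p else none := rfl

@[simp] lemma subtermAt_func_fin {l : ℕ} (f : L.Functions l) (ts : Fin l → L.Term V) (i : Fin l)
    (p : List ℕ) : subtermAt (.func f ts) ((i : ℕ) :: p) = subtermAt (ts i) p := by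
  simp [subtermAt_func_cons]

@[simp] lemma replaceAt_func_fin {l : ℕ} (f : L.Functions l) (ts : Fin l → L.Term V) (i : Fin l)
    (p : List ℕ) (u : L.Term V) :
    replaceAt (.func f ts) ((i : ℕ) :: p) u =
      .func f (Function.update ts i (replaceAt (ts i) p u)) := by
  simp only [replaceAt]
  congr 1
  funext j
  by_cases h : j = i
  · subst h; simp
  · simp [h, Fin.val_inj]

lemma exists_of_subtermAt_cons {t m : L.Term V} {i : ℕ} {p : List ℕ}
    (h : subtermAt t (i :: p) = some m) :
    ∃ (l : ℕ) (f : L.Functions l) (ts : Fin l → L.Term V) (j : Fin l),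
      t = .func f ts ∧ i = j ∧ subtermAt (ts j) p = some m := by
  cases t with
  | var x => simp at h
  | func f ts =>
    rw [subtermAt_func_cons] at h
    split_ifs at h with hi
    exact ⟨_, f, ts, ⟨i, hi⟩, rfl, rfl, h⟩

lemma subtermAt_append {t m : L.Term V} {p : List ℕ} (h : subtermAt t p = some m) (q : List ℕ) :
    subtermAt t (p ++ q) = subtermAt m q := by
  induction p generalizing t with
  | nil => simp at h; simp [h]
  | cons i p ih =>
    obtain ⟨l, f, ts, j, rfl, rfl, hj⟩ := exists_of_subtermAt_cons h
    simp [ih hj]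

lemma replaceAt_append {t m : L.Term V} {p : List ℕ} (h : subtermAt t p = some m) (q : List ℕ)
    (u : L.Term V) : replaceAt t (p ++ q) u = replaceAt t p (replaceAt m q u) := by
  induction p generalizing t with
  | nil => simp at h; simp [h]
  | cons i p ih =>
    obtain ⟨l, f, ts, j, rfl, rfl, hj⟩ := exists_of_subtermAt_cons h
    simp [ih hj]

lemma subtermAt_replaceAt {t : L.Term V} {p : List ℕ} (h : IsPos t p) (u : L.Term V) :
    subtermAt (replaceAt t p u) p = some u := by
  obtain ⟨m, h⟩ := h
  induction p generalizing t with
  | nil => simp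
  | cons i p ih =>
    obtain ⟨l, f, ts, j, rfl, rfl, hj⟩ := exists_of_subtermAt_cons h
    simp [ih hj]

lemma replaceAt_replaceAt {t : L.Term V} {p : List ℕ} (h : IsPos t p) (u u' : L.Term V) :
    replaceAt (replaceAt t p u) p u' = replaceAt t p u' := by
  obtain ⟨m, h⟩ := h
  induction p generalizing t with
  | nil => simp
  | cons i p ih =>
    obtain ⟨l, f, ts, j, rfl, rfl, hj⟩ := exists_of_subtermAt_cons h
    simp [ih hj]

lemma replaceAt_self {t m : L.Term V} {p : List ℕ} (h : subtermAt t p = some m) :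
    replaceAt t p m = t := by
  induction p generalizing t with
  | nil => simp at h; simp [h]
  | cons i p ih =>
    obtain ⟨l, f, ts, j, rfl, rfl, hj⟩ := exists_of_subtermAt_cons h
    simp [ih hj]

lemma subtermAt_subst {t m : L.Term V} {p : List ℕ} (h : subtermAt t p = some m)
    (σ : V → L.Term V) : subtermAt (t.subst σ) p = some (m.subst σ) := by
  induction p generalizing t with
  | nil => simp at h; simp [h]
  | cons i p ih =>
    obtain ⟨l, f, ts, j, rfl, rfl, hj⟩ := exists_of_subtermAt_cons h
    simpa [Term.subst] using ih hj

lemma replaceAt_subst {t : L.Term V} {p : List ℕ} (h : IsPos t p) (u : L.Term V)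
    (σ : V → L.Term V) :
    (replaceAt t p u).subst σ = replaceAt (t.subst σ) p (u.subst σ) := by
  obtain ⟨m, h⟩ := h
  induction p generalizing t with
  | nil => simp
  | cons i p ih =>
    obtain ⟨l, f, ts, j, rfl, rfl, hj⟩ := exists_of_subtermAt_cons h
    simp only [replaceAt_func_fin, Term.subst, ← ih hj]
    congr 1
    funext k
    by_cases hk : k = j
    · subst hk; simp [ih hj]
    · simp [hk]

/-- A position of `t.subst σ` either is a function position of `t` or lies inside the image of a
variable of `t`. -/
lemma subtermAt_subst_cases {t m : L.Term V} {p : List ℕ} {σ : V → L.Term V}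
    (h : subtermAt (t.subst σ) p = some m) :
    (∃ m', subtermAt t p = some m' ∧ (∀ x, m' ≠ .var x) ∧ m = m'.subst σ) ∨
      ∃ p₁ p₂ x, p = p₁ ++ p₂ ∧ subtermAt t p₁ = some (.var x) ∧
        subtermAt (σ x) p₂ = some m := by
  induction t generalizing p with
  | var x => exact .inr ⟨[], p, x, rfl, by simp, h⟩
  | func f ts ih =>
    cases p with
    | nil =>
      simp only [subtermAt_nil, Option.some.injEq] at h
      exact .inl ⟨.func f ts, by simp, by simp, h.symm⟩
    | cons i p =>
      obtain ⟨l, g, us, j, h1, rfl, h⟩ := exists_of_subtermAt_cons h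
      cases h1
      rcases ih j h with ⟨m', h1, h2⟩ | ⟨p₁, p₂, x, rfl, h1, h2⟩
      · exact .inl ⟨m', by simpa using h1, h2⟩
      · exact .inr ⟨j :: p₁, p₂, x, rfl, by simpa using h1, h2⟩

/-- Two positions are comparable, or replacements at them commute without affecting each other. -/
lemma position_cases {t a b : L.Term V} {p q : List ℕ} (hp : subtermAt t p = some a)
    (hq : subtermAt t q = some b) :
    (∃ r, q = p ++ r) ∨ (∃ r, p = q ++ r) ∨ ∀ u u',
      subtermAt (replaceAt t p u) q = some b ∧ subtermAt (replaceAt t q u') p = some a ∧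
        replaceAt (replaceAt t p u) q u' = replaceAt (replaceAt t q u') p u := by
  induction p generalizing t q with
  | nil => exact .inl ⟨q, rfl⟩
  | cons i p ih =>
    cases q with
    | nil => exact .inr (.inl ⟨_, rfl⟩)
    | cons k q =>
      obtain ⟨l, f, ts, i, rfl, rfl, hj⟩ := exists_of_subtermAt_cons hp
      obtain ⟨l', f', ts', k, h1, rfl, hk⟩ := exists_of_subtermAt_cons hq
      cases h1
      by_cases hik : i = k
      · subst hik
        rcases ih hj hk with ⟨r, rfl⟩ | ⟨r, rfl⟩ | h
        · exact .inl ⟨r, rfl⟩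
        · exact .inr (.inl ⟨r, rfl⟩)
        · refine .inr (.inr fun u u' => ?_)
          obtain ⟨h1, h2, h3⟩ := h u u'
          simp [h1, h2, h3]
      · refine .inr (.inr fun u u' => ?_)
        have hki : k ≠ i := Ne.symm hik
        simp [hik, hki, hj, hk, Function.update_comm hik]

lemma mem_vars_func {l : ℕ} {f : L.Functions l} {ts : Fin l → L.Term V} {x : V} :
    x ∈ vars (.func f ts) ↔ ∃ i, x ∈ vars (ts i) := by
  constructor
  · rintro ⟨p, hp⟩
    cases p with
    | nil => simp at hp
    | cons i p =>
      obtain ⟨_, _, _, j, h1, rfl, h⟩ := exists_of_subtermAt_cons hp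
      cases h1
      exact ⟨j, p, h⟩
  · rintro ⟨i, p, hp⟩
    exact ⟨i :: p, by simpa using hp⟩

@[simp] lemma vars_var (x : V) : vars (.var x : L.Term V) = {x} := by
  ext y
  constructor
  · rintro ⟨p, hp⟩
    cases p <;> simp_all
  · rintro rfl
    exact ⟨[], by simp⟩

lemma vars_subset_of_subtermAt {t m : L.Term V} {p : List ℕ} (h : subtermAt t p = some m) :
    vars m ⊆ vars t := by
  rintro x ⟨q, hq⟩
  exact ⟨p ++ q, by rw [subtermAt_append h, hq]⟩

lemma finite_vars (t : L.Term V) : (vars t).Finite := by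
  induction t with
  | var x => simp
  | func f ts ih =>
    refine (Set.finite_iUnion ih).subset fun x hx => ?_
    simpa using mem_vars_func.1 hx

lemma subst_congr {t : L.Term V} {σ τ : V → L.Term V} (h : ∀ x ∈ vars t, σ x = τ x) :
    t.subst σ = t.subst τ := by
  induction t with
  | var x => exact h x (by simp)
  | func f ts ih =>
    simp only [Term.subst]
    congr 1
    funext i
    exact ih i fun x hx => h x (mem_vars_func.2 ⟨i, hx⟩)

lemma eq_of_subst_eq {t : L.Term V} {σ τ : V → L.Term V} (h : t.subst σ = t.subst τ) {x : V}
    (hx : x ∈ vars t) : σ x = τ x := by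
  obtain ⟨p, hp⟩ := hx
  have h1 := subtermAt_subst hp σ
  rw [h, subtermAt_subst hp τ] at h1
  simpa [Term.subst] using h1.symm

lemma subst_subst (t : L.Term V) (σ τ : V → L.Term V) :
    (t.subst σ).subst τ = t.subst fun x => (σ x).subst τ := by
  induction t with
  | var x => rfl
  | func f ts ih => simp [Term.subst, ih]

lemma subst_var (t : L.Term V) : t.subst (fun x => .var x) = t := by
  induction t with
  | var x => rfl
  | func f ts ih => simp [Term.subst, ih]

lemma vars_rename (t : L.Term V) (π : V → V) :
    vars (t.subst fun x => .var (π x)) = π '' vars t := by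
  induction t with
  | var x => simp [Term.subst]
  | func f ts ih =>
    ext y
    simp only [Term.subst, mem_vars_func, ih, Set.mem_image]
    grind

section

/-! ### Closure of the rewrite relations under contexts and substitutions -/

/-- A relation is closed under contexts. -/
def ClosedUnderContexts (r : L.Term V → L.Term V → Prop) : Prop :=
  ∀ ⦃a b⦄, r a b → ∀ c p, IsPos c p → r (replaceAt c p a) (replaceAt c p b)

/-- A relation is closed under substitutions. -/
def ClosedUnderSubst (r : L.Term V → L.Term V → Prop) : Prop :=
  ∀ ⦃a b⦄, r a b → ∀ σ : V → L.Term V, r (a.subst σ) (b.subst σ)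

lemma ClosedUnderContexts.reflTransGen {r : L.Term V → L.Term V → Prop}
    (h : ClosedUnderContexts r) : ClosedUnderContexts (ReflTransGen r) :=
  fun _ _ hab c p hp => ReflTransGen.lift (replaceAt c p) (fun _ _ h' => h h' c p hp) _ _ hab

lemma ClosedUnderSubst.reflTransGen {r : L.Term V → L.Term V → Prop}
    (h : ClosedUnderSubst r) : ClosedUnderSubst (ReflTransGen r) :=
  fun _ _ hab σ => ReflTransGen.lift (fun t : L.Term V => t.subst σ) (fun _ _ h' => h h' σ) _ _ hab

variable {S R B : Set (L.Term V × L.Term V)}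

lemma step_root {ρ : L.Term V × L.Term V} (h : ρ ∈ S) (σ : V → L.Term V) :
    Step S (ρ.1.subst σ) (ρ.2.subst σ) := ⟨ρ, h, [], σ, by simp, by simp⟩

lemma step_of_mem {s t : L.Term V} (h : (s, t) ∈ S) : Step S s t := by
  simpa [subst_var] using step_root h fun x => .var x

lemma closedUnderContexts_step : ClosedUnderContexts (Step S) := by
  rintro a b ⟨ρ, hρ, q, σ, h1, rfl⟩ c p hp
  have h := subtermAt_replaceAt hp a
  refine ⟨ρ, hρ, p ++ q, σ, by rw [subtermAt_append h, h1], ?_⟩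
  rw [replaceAt_append h, replaceAt_replaceAt hp]

lemma closedUnderSubst_step : ClosedUnderSubst (Step S) := by
  rintro a b ⟨ρ, hρ, q, σ, h1, rfl⟩ τ
  refine ⟨ρ, hρ, q, fun x => (σ x).subst τ, ?_, ?_⟩
  · rw [subtermAt_subst h1, subst_subst]
  · rw [replaceAt_subst ⟨_, h1⟩, subst_subst]

lemma closedUnderContexts_symmStep : ClosedUnderContexts (SymmStep S) :=
  fun _ _ h c p hp => h.imp (closedUnderContexts_step · c p hp) (closedUnderContexts_step · c p hp)

lemma closedUnderSubst_symmStep : ClosedUnderSubst (SymmStep S) :=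
  fun _ _ h σ => h.imp (closedUnderSubst_step · σ) (closedUnderSubst_step · σ)

lemma closedUnderContexts_steps : ClosedUnderContexts (Steps S) :=
  closedUnderContexts_step.reflTransGen

lemma closedUnderSubst_steps : ClosedUnderSubst (Steps S) := closedUnderSubst_step.reflTransGen

lemma closedUnderContexts_conv : ClosedUnderContexts (Conv S) :=
  closedUnderContexts_symmStep.reflTransGen

lemma closedUnderSubst_conv : ClosedUnderSubst (Conv S) := closedUnderSubst_symmStep.reflTransGen

lemma closedUnderContexts_joinableMod : ClosedUnderContexts (JoinableMod R B) := by
  rintro a b ⟨a', b', h1, h2, h3⟩ c p hp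
  exact ⟨_, _, closedUnderContexts_steps h1 c p hp, closedUnderContexts_conv h2 c p hp,
    closedUnderContexts_steps h3 c p hp⟩

lemma closedUnderSubst_joinableMod : ClosedUnderSubst (JoinableMod R B) := by
  rintro a b ⟨a', b', h1, h2, h3⟩ σ
  exact ⟨_, _, closedUnderSubst_steps h1 σ, closedUnderSubst_conv h2 σ,
    closedUnderSubst_steps h3 σ⟩

lemma SymmStep.symm {s t : L.Term V} (h : SymmStep S s t) : SymmStep S t s := Or.symm h

lemma Conv.symm {s t : L.Term V} (h : Conv S s t) : Conv S t s := by
  have : Std.Symm (SymmStep S) := ⟨fun _ _ => SymmStep.symm⟩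
  exact ReflTransGen.stdSymm.symm _ _ h

lemma JoinableMod.symm {s t : L.Term V} (h : JoinableMod R B s t) : JoinableMod R B t s := by
  obtain ⟨s', t', h1, h2, h3⟩ := h
  exact ⟨t', s', h3, h2.symm, h1⟩

lemma JoinableMod.refl (s : L.Term V) : JoinableMod R B s s := ⟨s, s, .refl, .refl, .refl⟩

lemma Step.mono {S S' : Set (L.Term V × L.Term V)} (h : S ⊆ S') {s t : L.Term V}
    (hst : Step S s t) : Step S' s t := by
  obtain ⟨ρ, hρ, hrest⟩ := hst
  exact ⟨ρ, h hρ, hrest⟩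

lemma step_union {S S' : Set (L.Term V × L.Term V)} {s t : L.Term V} :
    Step (S ∪ S') s t ↔ Step S s t ∨ Step S' s t := by
  constructor
  · rintro ⟨ρ, hρ | hρ, h⟩
    exacts [.inl ⟨ρ, hρ, h⟩, .inr ⟨ρ, hρ, h⟩]
  · rintro (h | h)
    exacts [h.mono Set.subset_union_left, h.mono Set.subset_union_right]

/-- The rewrite relation of `S` is the least relation that contains the pairs of `S` and is closed
under contexts and substitutions. -/
lemma Step.induction {r : L.Term V → L.Term V → Prop} (hc : ClosedUnderContexts r)
    (hs : ClosedUnderSubst r) (h : ∀ ρ ∈ S, r ρ.1 ρ.2) {s t : L.Term V} (hst : Step S s t) :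
    r s t := by
  obtain ⟨ρ, hρ, p, σ, h1, rfl⟩ := hst
  have := hc (hs (h ρ hρ) σ) s p ⟨_, h1⟩
  rwa [replaceAt_self h1] at this

lemma step_symmetrize_iff {s t : L.Term V} : Step (symmetrize B) s t ↔ SymmStep B s t := by
  constructor
  · refine Step.induction closedUnderContexts_symmStep closedUnderSubst_symmStep ?_
    rintro ρ (hρ | hρ)
    exacts [.inl (step_of_mem hρ), .inr (step_of_mem hρ)]
  · have key : ∀ {a b : L.Term V}, Step B a b → Step (symmetrize B) b a := by
      rintro a b ⟨ρ, hρ, p, σ, h1, rfl⟩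
      refine ⟨(ρ.2, ρ.1), .inr hρ, p, σ, subtermAt_replaceAt ⟨_, h1⟩ _, ?_⟩
      rw [replaceAt_replaceAt ⟨_, h1⟩, replaceAt_self h1]
    rintro (h | h)
    exacts [h.mono Set.subset_union_left, key h]

/-- The multi-hole form of closure under contexts, for all arguments of a function symbol. -/
lemma reflTransGen_func {r : L.Term V → L.Term V → Prop} (hr : ClosedUnderContexts r) {l : ℕ}
    (f : L.Functions l) {ts us : Fin l → L.Term V} (h : ∀ i, ReflTransGen r (ts i) (us i)) :
    ReflTransGen r (.func f ts) (.func f us) := by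
  classical
  have key : ∀ s : Finset (Fin l),
      ReflTransGen r (.func f ts) (.func f fun i => if i ∈ s then us i else ts i) := by
    intro s
    induction s using Finset.induction_on with
    | empty => simpa using .refl
    | insert i s hi ih =>
      refine ih.trans ?_
      have hpos : IsPos (.func f fun i => if i ∈ s then us i else ts i) [(i : ℕ)] :=
        ⟨_, by rw [subtermAt_func_fin, subtermAt_nil]⟩
      have h1 := hr.reflTransGen (h i) _ _ hpos
      simp only [replaceAt_func_fin, replaceAt_nil] at h1
      convert h1 using 2
      · funext j
        by_cases hj : j = i
        · subst hj; simp [hi]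
        · simp [hj]
      · funext j
        by_cases hj : j = i
        · subst hj; simp
        · simp [hj]
  simpa using key Finset.univ

lemma reflTransGen_subst {r : L.Term V → L.Term V → Prop} (hr : ClosedUnderContexts r)
    {σ τ : V → L.Term V} (h : ∀ x, ReflTransGen r (σ x) (τ x)) (t : L.Term V) :
    ReflTransGen r (t.subst σ) (t.subst τ) := by
  induction t with
  | var x => exact h x
  | func f ts ih => exact reflTransGen_func hr f ih

lemma reflTransGen_subst_update {r : L.Term V → L.Term V → Prop} (hr : ClosedUnderContexts r)
    [DecidableEq V] {σ : V → L.Term V} {x : V} {y : L.Term V} (h : ReflTransGen r (σ x) y)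
    (t : L.Term V) : ReflTransGen r (t.subst σ) (t.subst (Function.update σ x y)) := by
  refine reflTransGen_subst hr (fun z => ?_) t
  by_cases hz : z = x
  · subst hz; simpa using h
  · simpa [hz] using .refl

/-- After one occurrence of `x` has been rewritten, the other occurrences can catch up. -/
lemma reflTransGen_replaceAt_subst_update {r : L.Term V → L.Term V → Prop}
    (hr : ClosedUnderContexts r) [DecidableEq V] {σ : V → L.Term V} {x : V} {y : L.Term V}
    (h : ReflTransGen r (σ x) y) {t : L.Term V} {p : List ℕ}
    (hp : subtermAt t p = some (.var x)) :
    ReflTransGen r (replaceAt (t.subst σ) p y) (t.subst (Function.update σ x y)) := by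
  induction p generalizing t with
  | nil => simp at hp; subst hp; simpa [Term.subst] using .refl
  | cons i p ih =>
    obtain ⟨l, f, ts, j, rfl, rfl, hj⟩ := exists_of_subtermAt_cons hp
    simp only [Term.subst, replaceAt_func_fin]
    refine reflTransGen_func hr f fun k => ?_
    by_cases hk : k = j
    · subst hk; simpa using ih hj
    · simpa [hk] using reflTransGen_subst_update hr h (ts k)

lemma replaceAt_subst_of_isLinear [DecidableEq V] {σ : V → L.Term V} {x : V} (y : L.Term V)
    {t : L.Term V} {p : List ℕ} (hp : subtermAt t p = some (.var x)) (ht : IsLinear t) :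
    replaceAt (t.subst σ) p y = t.subst (Function.update σ x y) := by
  induction p generalizing t with
  | nil => simp at hp; subst hp; simp [Term.subst]
  | cons i p ih =>
    obtain ⟨l, f, ts, j, rfl, rfl, hj⟩ := exists_of_subtermAt_cons hp
    simp only [Term.subst, replaceAt_func_fin]
    congr 1
    funext k
    by_cases hk : k = j
    · subst hk
      simp only [Function.update_self]
      refine ih hj fun z q q' hq hq' => ?_
      simpa using ht z (k :: q) (k :: q') (by simpa using hq) (by simpa using hq')
    · simp only [ne_eq, hk, not_false_eq_true, Function.update_of_ne]
      refine subst_congr fun z hz => ?_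
      obtain ⟨q, hq⟩ := hz
      have hzx : z ≠ x := by
        rintro rfl
        have := ht z (j :: p) (k :: q) (by simpa using hp) (by simpa using hq)
        simp only [List.cons.injEq, Fin.val_inj] at this
        exact hk this.1.symm
      simp [hzx]

end

/-! ### Most general unifiers -/

/-- The least equivalence relation on terms that relates `s` to `t` and is closed under
decomposition; it is contained in the kernel of every unifier of `s` and `t`. -/
inductive UnifEquiv (s t : L.Term V) : L.Term V → L.Term V → Prop
  | base : UnifEquiv s t s t
  | refl (a : L.Term V) : UnifEquiv s t a a
  | symm {a b : L.Term V} : UnifEquiv s t a b → UnifEquiv s t b a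
  | trans {a b c : L.Term V} : UnifEquiv s t a b → UnifEquiv s t b c → UnifEquiv s t a c
  | decomp {l : ℕ} {f : L.Functions l} {as bs : Fin l → L.Term V} :
      UnifEquiv s t (.func f as) (.func f bs) → ∀ i, UnifEquiv s t (as i) (bs i)

lemma UnifEquiv.subst_eq {s t a b : L.Term V} (h : UnifEquiv s t a b) {τ : V → L.Term V}
    (hτ : s.subst τ = t.subst τ) : a.subst τ = b.subst τ := by
  induction h with
  | base => exact hτ
  | refl => rfl
  | symm _ ih => exact ih.symm
  | trans _ _ ih ih' => exact ih.trans ih'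
  | decomp _ i ih =>
    simp only [Term.subst, Term.func.injEq, heq_eq_eq, true_and] at ih
    exact congrFun ih i

lemma UnifEquiv.eq_class {s t a b : L.Term V} (h : UnifEquiv s t a b) :
    UnifEquiv s t a = UnifEquiv s t b :=
  funext fun _ => propext ⟨fun h' => h.symm.trans h', fun h' => h.trans h'⟩

open Classical in
/-- The solved form of an equivalence class `C` of `UnifEquiv s t` whose members a unifier sends
to the term given as the last argument: a function symbol applied to the solved forms of the
arguments if the class contains such a term, and a representative variable otherwise. The
recursion is on the common image under the unifier. -/
noncomputable def solvedForm [Nonempty V] (s t : L.Term V) (C : L.Term V → Prop) :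
    L.Term V → L.Term V
  | .var _ => .var (Classical.epsilon fun y => C (.var y))
  | .func f zs =>
    if h : ∃ as, C (.func f as) then
      .func f fun i => solvedForm s t (UnifEquiv s t (h.choose i)) (zs i)
    else .var (Classical.epsilon fun y => C (.var y))

lemma solvedForm_func [Nonempty V] {s t : L.Term V} {l : ℕ} (f : L.Functions l)
    (as zs : Fin l → L.Term V) :
    solvedForm s t (UnifEquiv s t (.func f as)) (.func f zs) =
      .func f fun i => solvedForm s t (UnifEquiv s t (as i)) (zs i) := by
  have h : ∃ bs, UnifEquiv s t (.func f as) (.func f bs) := ⟨as, .refl _⟩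
  rw [solvedForm, dif_pos h]
  congr 1
  funext i
  rw [(h.choose_spec.decomp i).eq_class]

lemma subst_solvedForm [Nonempty V] {s t : L.Term V} (τ : V → L.Term V) (a : L.Term V) :
    a.subst (fun x => solvedForm s t (UnifEquiv s t (.var x)) (τ x)) =
      solvedForm s t (UnifEquiv s t a) (a.subst τ) := by
  induction a with
  | var x => rfl
  | func f as ih => simp only [Term.subst, solvedForm_func, ih]

/-- Every unifier factors through the solved forms. -/
lemma solvedForm_subst [Nonempty V] {s t : L.Term V} {τ : V → L.Term V}
    (hτ : s.subst τ = t.subst τ) {τ' : V → L.Term V} (hτ' : s.subst τ' = t.subst τ')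
    (a : L.Term V) :
    (solvedForm s t (UnifEquiv s t a) (a.subst τ)).subst τ' = a.subst τ' := by
  have hvar : ∀ x : V, a = .var x →
      (Term.var (Classical.epsilon fun y => UnifEquiv s t a (.var y)) : L.Term V).subst τ' =
        a.subst τ' := by
    intro x hx
    have : ∃ y, UnifEquiv s t a (.var y) := ⟨x, hx ▸ .refl _⟩
    exact ((Classical.epsilon_spec this).subst_eq hτ').symm
  generalize hz : a.subst τ = z
  induction z generalizing a with
  | var y =>
    cases a with
    | var x => exact hvar x rfl
    | func f as => simp [Term.subst] at hz
  | func f zs ih =>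
    rw [solvedForm]
    split_ifs with h
    · have hspec := h.choose_spec
      have hz' := hspec.subst_eq hτ
      rw [hz] at hz'
      simp only [Term.subst, Term.func.injEq, heq_eq_eq, true_and] at hz'
      rw [hspec.subst_eq hτ']
      simp only [Term.subst]
      congr 1
      funext i
      refine ih i _ (fun x hx => ?_) (congrFun hz' i).symm
      have : ∃ y, UnifEquiv s t (h.choose i) (.var y) := ⟨x, hx ▸ .refl _⟩
      exact ((Classical.epsilon_spec this).subst_eq hτ').symm
    · cases a with
      | var x => exact hvar x rfl
      | func g as =>
        simp only [Term.subst, Term.func.injEq] at hz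
        obtain ⟨rfl, hg, -⟩ := hz
        obtain rfl := eq_of_heq hg
        exact (h ⟨as, .refl _⟩).elim

/-- Unifiable terms have a most general unifier. -/
theorem exists_isMGU {s t : L.Term V} {τ : V → L.Term V} (hτ : s.subst τ = t.subst τ) :
    ∃ σ, IsMGU σ s t := by
  rcases isEmpty_or_nonempty V with hV | hV
  · exact ⟨τ, hτ, fun τ' _ => ⟨τ', fun x => hV.elim x⟩⟩
  · refine ⟨fun x => solvedForm s t (UnifEquiv s t (.var x)) (τ x), ?_, fun τ' hτ' => ⟨τ', ?_⟩⟩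
    · rw [subst_solvedForm, subst_solvedForm, hτ, (UnifEquiv.base (s := s) (t := t)).eq_class]
    · intro x
      exact (solvedForm_subst hτ hτ' (.var x)).symm

/-! ### Variants and critical peaks -/

lemma IsVariant.refl (ρ : L.Term V × L.Term V) : IsVariant ρ ρ :=
  ⟨Equiv.refl V, by simp [subst_var], by simp [subst_var]⟩

lemma IsVariant.trans {ρ₁ ρ₂ ρ₃ : L.Term V × L.Term V} (h : IsVariant ρ₁ ρ₂)
    (h' : IsVariant ρ₂ ρ₃) : IsVariant ρ₁ ρ₃ := by
  obtain ⟨π, h1, h2⟩ := h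
  obtain ⟨π', h3, h4⟩ := h'
  refine ⟨π.trans π', ?_, ?_⟩
  · rw [← h3, ← h1, subst_subst]; rfl
  · rw [← h4, ← h2, subst_subst]; rfl

lemma exists_perm_disjoint [Infinite V] {A C : Set V} (hA : A.Finite) (hC : C.Finite) :
    ∃ π : Equiv.Perm V, Disjoint (π '' A) C := by
  classical
  induction A, hA using Set.Finite.induction_on with
  | empty => exact ⟨Equiv.refl V, by simp⟩
  | @insert a s ha hs ih =>
    obtain ⟨π, hπ⟩ := ih
    -- A fresh name for `a`, away from the names already chosen.
    obtain ⟨b, hb⟩ := ((hs.image π).union hC).infinite_compl.nonempty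
    simp only [Set.mem_compl_iff, Set.mem_union, not_or] at hb
    refine ⟨π.trans (Equiv.swap (π a) b), ?_⟩
    rw [Set.disjoint_left] at hπ ⊢
    rintro _ ⟨x, rfl | hx, rfl⟩
    · simpa using hb.2
    · have h1 : π x ≠ π a := fun h => ha (π.injective h ▸ hx)
      have h2 : π x ≠ b := fun h => hb.1 ⟨x, hx, h⟩
      simpa [Equiv.swap_apply_of_ne_of_ne h1 h2] using hπ ⟨x, hx, rfl⟩

/-- An overlap at a function position is an instance of a critical peak. -/
lemma exists_isCriticalPeak [Infinite V] {R₁ R₂ : Set (L.Term V × L.Term V)}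
    {ρ₁ ρ₂ : L.Term V × L.Term V} (h₁ : ρ₁ ∈ R₁) (h₂ : ρ₂ ∈ R₂) {p : List ℕ} {m : L.Term V}
    (hm : subtermAt ρ₂.1 p = some m) (hmv : ∀ x, m ≠ .var x) {τ₁ τ₂ : V → L.Term V}
    (hτ : ρ₁.1.subst τ₁ = m.subst τ₂) (hp : p = [] → ¬ IsVariant ρ₁ ρ₂) :
    ∃ (t s u : L.Term V) (δ : V → L.Term V), IsCriticalPeak R₁ R₂ t p s u ∧
      t.subst δ = replaceAt (ρ₂.1.subst τ₂) p (ρ₁.2.subst τ₁) ∧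
      s.subst δ = ρ₂.1.subst τ₂ ∧ u.subst δ = ρ₂.2.subst τ₂ := by
  classical
  obtain ⟨π, hπ⟩ := exists_perm_disjoint
    ((finite_vars ρ₁.1).union (finite_vars ρ₁.2)) ((finite_vars ρ₂.1).union (finite_vars ρ₂.2))
  set ρ : L.Term V × L.Term V :=
    (ρ₁.1.subst fun x => .var (π x), ρ₁.2.subst fun x => .var (π x)) with hρ
  have hvar : IsVariant ρ₁ ρ := ⟨π, rfl, rfl⟩
  have hdisj : Disjoint (vars ρ.1 ∪ vars ρ.2) (vars ρ₂.1 ∪ vars ρ₂.2) := by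
    rwa [hρ, vars_rename, vars_rename, ← Set.image_union]
  -- The two matching substitutions combine, as the renamed pair shares no variable with `ρ₂`.
  set τ : V → L.Term V :=
    fun x => if x ∈ vars ρ₂.1 ∪ vars ρ₂.2 then τ₂ x else τ₁ (π.symm x) with hτdef
  have e2 : ∀ {a : L.Term V}, vars a ⊆ vars ρ₂.1 ∪ vars ρ₂.2 → a.subst τ = a.subst τ₂ :=
    fun ha => subst_congr fun x hx => by simp only [hτdef, if_pos (ha hx)]
  have e1 : ∀ {a : L.Term V}, vars a ⊆ vars ρ₁.1 ∪ vars ρ₁.2 →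
      (a.subst fun x => .var (π x)).subst τ = a.subst τ₁ := by
    intro a ha
    rw [subst_subst]
    refine subst_congr fun x hx => ?_
    have : π x ∉ vars ρ₂.1 ∪ vars ρ₂.2 := Set.disjoint_left.1 hπ ⟨x, ha hx, rfl⟩
    simp only [Term.subst, hτdef, if_neg this, Equiv.symm_apply_apply]
  have hunif : ρ.1.subst τ = m.subst τ := by
    rw [e2 ((vars_subset_of_subtermAt hm).trans Set.subset_union_left), ← hτ]
    exact e1 Set.subset_union_left
  obtain ⟨σ, hσ⟩ := exists_isMGU hunif
  obtain ⟨δ, hδ⟩ := hσ.2 τ hunif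
  have hfac : ∀ a : L.Term V, (a.subst σ).subst δ = a.subst τ := fun a => by
    rw [subst_subst]; exact subst_congr fun x _ => (hδ x).symm
  refine ⟨_, _, _, δ, ⟨ρ, ρ₂, m, σ, ⟨ρ₁, h₁, hvar⟩, ⟨ρ₂, h₂, .refl _⟩, hdisj, hm, hmv, hσ,
    fun h h' => hp h (hvar.trans h'), rfl, rfl, rfl⟩, ?_, ?_, ?_⟩
  · rw [replaceAt_subst ⟨_, subtermAt_subst hm σ⟩, hfac, hfac, e2 Set.subset_union_left]
    congr 1
    exact e1 Set.subset_union_right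
  · rw [hfac, e2 Set.subset_union_left]
  · rw [hfac, e2 Set.subset_union_right]

section

variable {S R B R₁ R₂ : Set (L.Term V × L.Term V)}

/-! ### Peaks and cliffs -/

/-- The pairs `a`, `b` that are joinable modulo `B` or connected by a prime critical pair inside a
context. -/
def Linked (R B : Set (L.Term V × L.Term V)) (a b : L.Term V) : Prop :=
  JoinableMod R B a b ∨ SymmStep (PCP R ∪ PCPpm R B) a b

lemma Linked.refl (a : L.Term V) : Linked R B a a := .inl (.refl a)

lemma Linked.symm {a b : L.Term V} (h : Linked R B a b) : Linked R B b a :=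
  h.imp JoinableMod.symm SymmStep.symm

lemma closedUnderContexts_linked : ClosedUnderContexts (Linked R B) := fun _ _ h c p hp =>
  h.imp (closedUnderContexts_joinableMod · c p hp) (closedUnderContexts_symmStep · c p hp)

/-- The kinds of overlaps (inner pair from `R₁`, outer pair from `R₂`) that involve `R`. -/
def IsOverlapKind (R B R₁ R₂ : Set (L.Term V × L.Term V)) : Prop :=
  (R₁ = R ∧ R₂ = R) ∨ (R₁ = R ∧ R₂ = symmetrize B) ∨ (R₁ = symmetrize B ∧ R₂ = R)

lemma IsOverlapKind.subset (h : IsOverlapKind R B R₁ R₂) :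
    primeCriticalPairs R R₁ R₂ ⊆ PCP R ∪ PCPpm R B := by
  rcases h with ⟨rfl, rfl⟩ | ⟨rfl, rfl⟩ | ⟨rfl, rfl⟩
  exacts [Set.subset_union_left, Set.subset_union_left.trans Set.subset_union_right,
    Set.subset_union_right.trans Set.subset_union_right]

/-- No rule of `R` is a variant of an equation of `B`. -/
def VariantFree (R B : Set (L.Term V × L.Term V)) : Prop :=
  ∀ ρ ∈ R, ∀ e ∈ symmetrize B, ¬ IsVariant ρ e ∧ ¬ IsVariant e ρ

lemma conv_of_step_symmetrize {a b : L.Term V} (h : Step (symmetrize B) a b) : Conv B a b :=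
  .single (step_symmetrize_iff.1 h)

/-- Variable overlaps are joinable; left-linearity is needed if the inner step uses `B`. -/
lemma joinableMod_of_variable_overlap (hk : IsOverlapKind R B R₁ R₂) (hl : IsLeftLinear R)
    {ρ₂ : L.Term V × L.Term V} (h₂ : ρ₂ ∈ R₂) {τ : V → L.Term V} {p : List ℕ} {x : V}
    (hp : subtermAt ρ₂.1 p = some (.var x)) {y : L.Term V} (hy : Step R₁ (τ x) y) :
    JoinableMod R B (replaceAt (ρ₂.1.subst τ) p y) (ρ₂.2.subst τ) := by
  classical
  have houter := step_root h₂ (Function.update τ x y)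
  rcases hk with ⟨rfl, rfl⟩ | ⟨rfl, rfl⟩ | ⟨rfl, rfl⟩
  · exact ⟨_, _, (reflTransGen_replaceAt_subst_update closedUnderContexts_step
      (.single hy) hp).trans (.single houter), .refl,
      reflTransGen_subst_update closedUnderContexts_step (.single hy) _⟩
  · exact ⟨_, _, reflTransGen_replaceAt_subst_update closedUnderContexts_step (.single hy) hp,
      conv_of_step_symmetrize houter,
      reflTransGen_subst_update closedUnderContexts_step (.single hy) _⟩
  · rw [replaceAt_subst_of_isLinear y hp (hl _ h₂)]
    refine ⟨_, _, .single houter, Conv.symm ?_, .refl⟩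
    exact reflTransGen_subst_update closedUnderContexts_symmStep
      (conv_of_step_symmetrize hy) _

/-- Variant rules applied at the same position give the same result. -/
lemma eq_of_isVariant {ρ₁ ρ₂ : L.Term V × L.Term V} (h : IsVariant ρ₁ ρ₂)
    (hv : vars ρ₁.2 ⊆ vars ρ₁.1) {τ₁ τ₂ : V → L.Term V}
    (hτ : ρ₂.1.subst τ₂ = ρ₁.1.subst τ₁) : ρ₁.2.subst τ₁ = ρ₂.2.subst τ₂ := by
  obtain ⟨π, h1, h2⟩ := h
  rw [← h1, subst_subst] at hτ
  rw [← h2, subst_subst]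
  exact subst_congr fun x hx => (eq_of_subst_eq hτ (hv hx)).symm

/-- An overlap whose inner redex has only normal forms as proper subterms. -/
lemma linked_of_prime_overlap [Infinite V] (hR : IsTRS R) (hl : IsLeftLinear R)
    (hvf : VariantFree R B) (hk : IsOverlapKind R B R₁ R₂) {ρ₁ ρ₂ : L.Term V × L.Term V}
    (h₁ : ρ₁ ∈ R₁) (h₂ : ρ₂ ∈ R₂) {τ₁ τ₂ : V → L.Term V} {p : List ℕ}
    (hp : subtermAt (ρ₂.1.subst τ₂) p = some (ρ₁.1.subst τ₁))
    (hnf : ∀ q m, q ≠ [] → subtermAt (ρ₁.1.subst τ₁) q = some m → IsNF R m) :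
    Linked R B (replaceAt (ρ₂.1.subst τ₂) p (ρ₁.2.subst τ₁)) (ρ₂.2.subst τ₂) := by
  rcases subtermAt_subst_cases hp with ⟨m, hm, hmv, hτ⟩ | ⟨p₁, p₂, x, rfl, hx, hx'⟩
  · by_cases hvar : p = [] ∧ IsVariant ρ₁ ρ₂
    · obtain ⟨rfl, hvar⟩ := hvar
      rcases hk with ⟨rfl, rfl⟩ | ⟨rfl, rfl⟩ | ⟨rfl, rfl⟩
      · simp only [subtermAt_nil, Option.some.injEq] at hp
        rw [replaceAt_nil, eq_of_isVariant hvar (hR _ h₁).2 hp]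
        exact .refl _
      · exact ((hvf _ h₁ _ h₂).1 hvar).elim
      · exact ((hvf _ h₂ _ h₁).2 hvar).elim
    · obtain ⟨t, s, u, δ, hpeak, ht, hs, hu⟩ :=
        exists_isCriticalPeak h₁ h₂ hm hmv hτ fun h h' => hvar ⟨h, h'⟩
      have hmem : (t, u) ∈ primeCriticalPairs R R₁ R₂ := by
        refine ⟨p, s, hpeak, fun m' hm' q m'' hq hm'' b hb => ?_⟩
        have h := subtermAt_subst hm' δ
        rw [hs, hp, Option.some.injEq] at h
        have h' := subtermAt_subst hm'' δ
        rw [← h] at h'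
        exact hnf q _ hq h' _ (closedUnderSubst_step hb δ)
      have := closedUnderSubst_step (step_of_mem (hk.subset hmem)) δ
      rw [ht, hu] at this
      exact .inr (.inl this)
  · have hpos := subtermAt_subst hx τ₂
    rw [replaceAt_append hpos]
    exact .inl (joinableMod_of_variable_overlap hk hl h₂ hx ⟨ρ₁, h₁, p₂, τ₁, hx', rfl⟩)

lemma IsNF.subterm {t m : L.Term V} {p : List ℕ} (h : IsNF R t) (hm : subtermAt t p = some m) :
    IsNF R m := by
  intro b hb
  have := closedUnderContexts_step hb t p ⟨_, hm⟩
  rw [replaceAt_self hm] at this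
  exact h _ this

/-- A reducible term contains an innermost redex. -/
lemma exists_innermost_redex {t : L.Term V} (h : ¬ IsNF R t) :
    ∃ p, ∃ ρ ∈ R, ∃ σ : V → L.Term V, subtermAt t p = some (ρ.1.subst σ) ∧
      ∀ q m, q ≠ [] → subtermAt (ρ.1.subst σ) q = some m → IsNF R m := by
  have hred : ∃ b, Step R t b := by simpa [IsNF] using h
  obtain ⟨b, ρ, hρ, p, σ, hp, -⟩ := hred
  clear h b
  induction t generalizing ρ p σ with
  | var x =>
    cases p with
    | nil =>
      simp only [subtermAt_nil, Option.some.injEq] at hp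
      refine ⟨[], ρ, hρ, σ, by simpa using hp, fun q m hq hm => ?_⟩
      rw [← hp] at hm
      cases q with
      | nil => exact (hq rfl).elim
      | cons i q => simp at hm
    | cons i p => simp at hp
  | func f ts ih =>
    by_cases hnf : ∀ i, IsNF R (ts i)
    · cases p with
      | nil =>
        simp only [subtermAt_nil, Option.some.injEq] at hp
        refine ⟨[], ρ, hρ, σ, by simpa using hp, fun q m hq hm => ?_⟩
        rw [← hp] at hm
        cases q with
        | nil => exact (hq rfl).elim
        | cons i q =>
          obtain ⟨_, _, _, j, h1, rfl, hj⟩ := exists_of_subtermAt_cons hm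
          cases h1
          exact (hnf j).subterm hj
      | cons i p =>
        obtain ⟨_, _, _, j, h1, rfl, hj⟩ := exists_of_subtermAt_cons hp
        cases h1
        exact (((hnf j).subterm hj) _ (step_root hρ σ)).elim
    · push Not at hnf
      obtain ⟨i, hi⟩ := hnf
      have : ∃ b, Step R (ts i) b := by simpa [IsNF] using hi
      obtain ⟨b, ρ', hρ', p', σ', hp', -⟩ := this
      obtain ⟨p'', ρ'', h1, σ'', h2, h3⟩ := ih i ρ' hρ' p' σ' hp'
      exact ⟨i :: p'', ρ'', h1, σ'', by simpa using h2, h3⟩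

/-- An arbitrary overlap splits into two linked pairs at a further reduct of its source. If the
overlap is not prime, this reduct contracts an innermost redex strictly below the inner one. -/
lemma exists_linked_of_overlap [Infinite V] (hR : IsTRS R) (hl : IsLeftLinear R)
    (hvf : VariantFree R B) (hk : IsOverlapKind R B R₁ R₂) {ρ₁ ρ₂ : L.Term V × L.Term V}
    (h₁ : ρ₁ ∈ R₁) (h₂ : ρ₂ ∈ R₂) {τ₁ τ₂ : V → L.Term V} {p : List ℕ}
    (hp : subtermAt (ρ₂.1.subst τ₂) p = some (ρ₁.1.subst τ₁)) :
    ∃ v, Step R (ρ₂.1.subst τ₂) v ∧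
      Linked R B (replaceAt (ρ₂.1.subst τ₂) p (ρ₁.2.subst τ₁)) v ∧
      Linked R B v (ρ₂.2.subst τ₂) := by
  by_cases hnf : ∀ q m, q ≠ [] → subtermAt (ρ₁.1.subst τ₁) q = some m → IsNF R m
  · have hlink := linked_of_prime_overlap hR hl hvf hk h₁ h₂ hp hnf
    have hinner : Step R₁ (ρ₂.1.subst τ₂) (replaceAt (ρ₂.1.subst τ₂) p (ρ₁.2.subst τ₁)) :=
      ⟨ρ₁, h₁, p, τ₁, hp, rfl⟩
    rcases hk with ⟨rfl, rfl⟩ | ⟨rfl, rfl⟩ | ⟨rfl, rfl⟩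
    · exact ⟨_, hinner, .refl _, hlink⟩
    · exact ⟨_, hinner, .refl _, hlink⟩
    · exact ⟨_, step_root h₂ τ₂, hlink, .refl _⟩
  · push Not at hnf
    obtain ⟨q, m, hq, hm, hmred⟩ := hnf
    obtain ⟨q', ρ₃, h₃, τ₃, hq', hnf'⟩ := exists_innermost_redex hmred
    have hQ : subtermAt (ρ₁.1.subst τ₁) (q ++ q') = some (ρ₃.1.subst τ₃) := by
      rw [subtermAt_append hm, hq']
    have hpQ : subtermAt (ρ₂.1.subst τ₂) (p ++ (q ++ q')) = some (ρ₃.1.subst τ₃) := by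
      rw [subtermAt_append hp, hQ]
    have hk₁ : IsOverlapKind R B R R₁ := by
      rcases hk with ⟨rfl, -⟩ | ⟨rfl, -⟩ | ⟨rfl, -⟩
      exacts [.inl ⟨rfl, rfl⟩, .inl ⟨rfl, rfl⟩, .inr (.inl ⟨rfl, rfl⟩)]
    have hk₂ : IsOverlapKind R B R R₂ := by
      rcases hk with ⟨-, rfl⟩ | ⟨-, rfl⟩ | ⟨-, rfl⟩
      exacts [.inl ⟨rfl, rfl⟩, .inr (.inl ⟨rfl, rfl⟩), .inl ⟨rfl, rfl⟩]
    refine ⟨replaceAt (ρ₂.1.subst τ₂) (p ++ (q ++ q')) (ρ₃.2.subst τ₃),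
      ⟨ρ₃, h₃, _, τ₃, hpQ, rfl⟩, ?_, linked_of_prime_overlap hR hl hvf hk₂ h₃ h₂ hpQ hnf'⟩
    rw [replaceAt_append hp]
    exact closedUnderContexts_linked
      (linked_of_prime_overlap hR hl hvf hk₁ h₃ h₁ hQ hnf').symm _ p ⟨_, hp⟩

lemma exists_linked_of_peak_aux [Infinite V] (hR : IsTRS R) (hl : IsLeftLinear R)
    (hvf : VariantFree R B) (hS : S = R ∨ S = symmetrize B) {w s t : L.Term V}
    (hs : Step R w s) (ht : Step S w t) :
    ∃ v, Step R w v ∧ Linked R B s v ∧ Linked R B v t := by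
  have hk₁ : IsOverlapKind R B R S := by
    rcases hS with rfl | rfl
    exacts [.inl ⟨rfl, rfl⟩, .inr (.inl ⟨rfl, rfl⟩)]
  have hk₂ : IsOverlapKind R B S R := by
    rcases hS with rfl | rfl
    exacts [.inl ⟨rfl, rfl⟩, .inr (.inr ⟨rfl, rfl⟩)]
  have hs' := hs
  obtain ⟨ρ, hρ, p, τ, hp, rfl⟩ := hs
  obtain ⟨ρ', hρ', q, τ', hq, rfl⟩ := ht
  rcases position_cases hp hq with ⟨r, rfl⟩ | ⟨r, rfl⟩ | hpar
  · rw [subtermAt_append hp] at hq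
    obtain ⟨v, h1, h2, h3⟩ := exists_linked_of_overlap hR hl hvf hk₂ hρ' hρ hq
    have h := closedUnderContexts_step h1 w p ⟨_, hp⟩
    rw [replaceAt_self hp] at h
    rw [replaceAt_append hp]
    exact ⟨_, h, closedUnderContexts_linked h3.symm w p ⟨_, hp⟩,
      closedUnderContexts_linked h2.symm w p ⟨_, hp⟩⟩
  · rw [subtermAt_append hq] at hp
    obtain ⟨v, h1, h2, h3⟩ := exists_linked_of_overlap hR hl hvf hk₁ hρ hρ' hp
    have h := closedUnderContexts_step h1 w q ⟨_, hq⟩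
    rw [replaceAt_self hq] at h
    rw [replaceAt_append hq]
    exact ⟨_, h, closedUnderContexts_linked h2 w q ⟨_, hq⟩,
      closedUnderContexts_linked h3 w q ⟨_, hq⟩⟩
  · obtain ⟨h1, h2, h3⟩ := hpar (ρ.2.subst τ) (ρ'.2.subst τ')
    refine ⟨_, hs', .refl _, .inl ?_⟩
    have hS' : Step S (replaceAt w p (ρ.2.subst τ))
        (replaceAt (replaceAt w p (ρ.2.subst τ)) q (ρ'.2.subst τ')) := ⟨ρ', hρ', q, τ', h1, rfl⟩
    have hR' : Step R (replaceAt w q (ρ'.2.subst τ'))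
        (replaceAt (replaceAt w p (ρ.2.subst τ)) q (ρ'.2.subst τ')) :=
      h3 ▸ ⟨ρ, hρ, p, τ, h2, rfl⟩
    rcases hS with rfl | rfl
    · exact ⟨_, _, .single hS', .refl, .single hR'⟩
    · exact ⟨_, _, .refl, conv_of_step_symmetrize hS', .single hR'⟩

/-- Every local peak and every local cliff splits at a further reduct of its source into two
linked pairs. -/
theorem exists_linked_of_peak [Infinite V] (hR : IsTRS R) (hl : IsLeftLinear R)
    (hvf : VariantFree R B) {w s t : L.Term V} (hs : Step R w s)
    (ht : Step R w t ∨ SymmStep B w t) :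
    ∃ v, Step R w v ∧ Linked R B s v ∧ Linked R B v t := by
  rcases ht with ht | ht
  · exact exists_linked_of_peak_aux hR hl hvf (.inl rfl) hs ht
  · exact exists_linked_of_peak_aux hR hl hvf (.inr rfl) hs (step_symmetrize_iff.2 ht)

end

section

variable {R B E R' E' : Set (L.Term V × L.Term V)} {gt : L.Term V → L.Term V → Prop}

/-! ### Reduction orders -/

/-- All rules of `R` are oriented by the order. -/
def OrientedBy (gt : L.Term V → L.Term V → Prop) (R : Set (L.Term V × L.Term V)) : Prop :=
  ∀ ρ ∈ R, gt ρ.1 ρ.2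

lemma IsReductionOrder.irrefl (h : IsReductionOrder B gt) (a : L.Term V) : ¬ gt a a :=
  fun ha => h.wf.irrefl.irrefl a ha

lemma IsReductionOrder.not_conv (h : IsReductionOrder B gt) {a b : L.Term V} (hab : gt a b)
    (hc : Conv B b a) : False :=
  h.irrefl a (h.compatible a a b a .refl hab hc)

lemma IsReductionOrder.gt_of_conv_right (h : IsReductionOrder B gt) {a b c : L.Term V}
    (hab : gt a b) (hbc : Conv B b c) : gt a c :=
  h.compatible a a b c .refl hab hbc

lemma IsReductionOrder.gt_of_conv_left (h : IsReductionOrder B gt) {a b c : L.Term V}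
    (hab : Conv B a b) (hbc : gt b c) : gt a c :=
  h.compatible a b c c hab hbc .refl

lemma OrientedBy.gt_of_step (hR : OrientedBy gt R) (h : IsReductionOrder B gt) {a b : L.Term V}
    (hab : Step R a b) : gt a b :=
  Step.induction (r := gt) (fun _ _ => h.context _ _) (fun _ _ => h.subst _ _) hR hab

/-- A term is not greater than a term that contains it: iterating the context would give an
infinite descending sequence. -/
lemma IsReductionOrder.not_gt_replaceAt (h : IsReductionOrder B gt) {c : L.Term V} {p : List ℕ}
    (hp : IsPos c p) (a : L.Term V) : ¬ gt a (replaceAt c p a) := by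
  induction a using h.wf.induction with
  | _ a ih => exact fun ha => ih _ ha (h.context _ _ ha c p hp)

lemma IsReductionOrder.not_gt_of_subterm (h : IsReductionOrder B gt) {a b : L.Term V}
    {p : List ℕ} (hp : subtermAt b p = some a) : ¬ gt a b := by
  have := h.not_gt_replaceAt ⟨_, hp⟩ a
  rwa [replaceAt_self hp] at this

lemma OrientedBy.isTRS (hR : OrientedBy gt R) (h : IsReductionOrder B gt) : IsTRS R := by
  classical
  intro ρ hρ
  have hgt := hR ρ hρ
  have hvars : vars ρ.2 ⊆ vars ρ.1 := by
    rintro y ⟨p, hp⟩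
    by_contra hy
    -- Instantiating an extra variable by the left-hand side embeds it in the right-hand side.
    have h1 := h.subst _ _ hgt (Function.update (fun x => .var x) y ρ.1)
    have h2 : ρ.1.subst (Function.update (fun x => .var x) y ρ.1) = ρ.1 := by
      conv_rhs => rw [← subst_var ρ.1]
      refine subst_congr fun x hx => ?_
      have : x ≠ y := by rintro rfl; exact hy hx
      simp [this]
    rw [h2] at h1
    have h3 := subtermAt_subst hp (Function.update (fun x => .var x) y ρ.1)
    exact h.not_gt_of_subterm (by simpa [Term.subst] using h3) h1
  refine ⟨fun x hx => ?_, hvars⟩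
  rw [hx] at hgt hvars
  by_cases hxr : x ∈ vars ρ.2
  · obtain ⟨p, hp⟩ := hxr
    exact h.not_gt_of_subterm hp hgt
  · have h1 := h.subst _ _ hgt (Function.update (fun x => .var x) x ρ.2)
    have h2 : ρ.2.subst (Function.update (fun x => .var x) x ρ.2) = ρ.2 := by
      conv_rhs => rw [← subst_var ρ.2]
      refine subst_congr fun y hy => ?_
      have : y ≠ x := by rintro rfl; exact hxr hy
      simp [this]
    rw [h2] at h1
    exact h.irrefl ρ.2 (by simpa [Term.subst] using h1)

lemma OrientedBy.variantFree (hR : OrientedBy gt R) (h : IsReductionOrder B gt) :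
    VariantFree R B := by
  have hconv : ∀ e ∈ symmetrize B, Conv B e.2 e.1 := fun e he =>
    (conv_of_step_symmetrize (step_of_mem he)).symm
  refine fun ρ hρ e he => ⟨?_, ?_⟩
  · rintro ⟨π, h1, h2⟩
    have := h.subst _ _ (hR ρ hρ) fun x => .var (π x)
    rw [h1, h2] at this
    exact h.not_conv this (hconv e he)
  · rintro ⟨π, h1, h2⟩
    have := closedUnderSubst_conv (hconv e he) fun x => .var (π x)
    rw [h1, h2] at this
    exact h.not_conv (hR ρ hρ) this

lemma OrientedBy.terminatingMod (hR : OrientedBy gt R) (h : IsReductionOrder B gt) :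
    TerminatingMod R B := by
  rintro ⟨f, hf⟩
  refine (wellFounded_iff_isEmpty_descending_chain.1 h.wf).false ⟨f, fun i => ?_⟩
  obtain ⟨s, t, h1, h2, h3⟩ := hf i
  exact h.compatible _ _ _ _ h1 (hR.gt_of_step h h2) h3

/-! ### Simulation of equations and rules along inference steps -/

/-- How an equation step appears after one inference step. -/
def SimulatesEq (B E R : Set (L.Term V × L.Term V)) (a b : L.Term V) : Prop :=
  SymmStep E a b ∨ SymmStep R a b ∨ Conv B a b ∨ (∃ c, Step R a c ∧ SymmStep E c b) ∨
    ∃ c, Step R b c ∧ SymmStep E a c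

/-- How a rewrite step appears after one inference step. -/
def SimulatesRule (E R : Set (L.Term V × L.Term V)) (a b : L.Term V) : Prop :=
  Step R a b ∨ (∃ c, Step R a c ∧ SymmStep E c b) ∨ ∃ c, Step R a c ∧ Step R b c

lemma SimulatesEq.symm {a b : L.Term V} (h : SimulatesEq B E R a b) : SimulatesEq B E R b a := by
  rcases h with h | h | h | ⟨c, h, h'⟩ | ⟨c, h, h'⟩
  exacts [.inl h.symm, .inr (.inl h.symm), .inr (.inr (.inl h.symm)),
    .inr (.inr (.inr (.inr ⟨c, h, h'.symm⟩))), .inr (.inr (.inr (.inl ⟨c, h, h'.symm⟩)))]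

lemma closedUnderContexts_simulatesEq : ClosedUnderContexts (SimulatesEq B E R) := by
  intro a b h c p hp
  rcases h with h | h | h | ⟨d, h, h'⟩ | ⟨d, h, h'⟩
  exacts [.inl (closedUnderContexts_symmStep h c p hp),
    .inr (.inl (closedUnderContexts_symmStep h c p hp)),
    .inr (.inr (.inl (closedUnderContexts_conv h c p hp))),
    .inr (.inr (.inr (.inl ⟨_, closedUnderContexts_step h c p hp,
      closedUnderContexts_symmStep h' c p hp⟩))),
    .inr (.inr (.inr (.inr ⟨_, closedUnderContexts_step h c p hp,
      closedUnderContexts_symmStep h' c p hp⟩)))]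

lemma closedUnderSubst_simulatesEq : ClosedUnderSubst (SimulatesEq B E R) := by
  intro a b h σ
  rcases h with h | h | h | ⟨d, h, h'⟩ | ⟨d, h, h'⟩
  exacts [.inl (closedUnderSubst_symmStep h σ),
    .inr (.inl (closedUnderSubst_symmStep h σ)),
    .inr (.inr (.inl (closedUnderSubst_conv h σ))),
    .inr (.inr (.inr (.inl ⟨_, closedUnderSubst_step h σ, closedUnderSubst_symmStep h' σ⟩))),
    .inr (.inr (.inr (.inr ⟨_, closedUnderSubst_step h σ, closedUnderSubst_symmStep h' σ⟩)))]

lemma closedUnderContexts_simulatesRule : ClosedUnderContexts (SimulatesRule E R) := by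
  intro a b h c p hp
  rcases h with h | ⟨d, h, h'⟩ | ⟨d, h, h'⟩
  exacts [.inl (closedUnderContexts_step h c p hp),
    .inr (.inl ⟨_, closedUnderContexts_step h c p hp, closedUnderContexts_symmStep h' c p hp⟩),
    .inr (.inr ⟨_, closedUnderContexts_step h c p hp, closedUnderContexts_step h' c p hp⟩)]

lemma closedUnderSubst_simulatesRule : ClosedUnderSubst (SimulatesRule E R) := by
  intro a b h σ
  rcases h with h | ⟨d, h, h'⟩ | ⟨d, h, h'⟩
  exacts [.inl (closedUnderSubst_step h σ),
    .inr (.inl ⟨_, closedUnderSubst_step h σ, closedUnderSubst_symmStep h' σ⟩),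
    .inr (.inr ⟨_, closedUnderSubst_step h σ, closedUnderSubst_step h' σ⟩)]

lemma StepB.simulatesEq_of_mem (h : StepB B gt E R E' R') :
    ∀ e ∈ E, SimulatesEq B E' R' e.1 e.2 := by
  have keep : ∀ {e : L.Term V × L.Term V} {E R : Set (L.Term V × L.Term V)}, e ∈ E →
      SimulatesEq B E R e.1 e.2 := fun he => .inl (.inl (step_of_mem he))
  cases h with
  | deduce _ _ s m t => exact fun e he => keep (.inl he)
  | orient _ _ s t e' he' _ hgt =>
    rintro e (he | rfl)
    · exact keep he
    · have hst : SymmStep (R ∪ {(s, t)}) s t := .inl (step_of_mem (.inr rfl))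
      rcases he' with rfl | rfl
      exacts [.inr (.inl hst), .inr (.inl hst.symm)]
  | delete _ _ s t _ hc =>
    rintro e (he | rfl)
    · exact keep he
    · exact .inr (.inr (.inl hc))
  | simplify E₀ _ s t t' e' he' _ hst =>
    rintro e (he | rfl)
    · exact keep (.inl he)
    · have h1 : SimulatesEq B (E₀ ∪ {(t', t)}) R s t :=
        .inr (.inr (.inr (.inl ⟨t', hst, .inl (step_of_mem (.inr rfl))⟩)))
      rcases he' with rfl | rfl
      exacts [h1, h1.symm]
  | collapse => exact fun e he => keep (.inl he)
  | compose => exact fun e he => keep he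

lemma StepB.simulatesRule_of_mem (h : StepB B gt E R E' R') :
    ∀ ρ ∈ R, SimulatesRule E' R' ρ.1 ρ.2 := by
  have keep : ∀ {ρ : L.Term V × L.Term V} {E R : Set (L.Term V × L.Term V)}, ρ ∈ R →
      SimulatesRule E R ρ.1 ρ.2 := fun he => .inl (step_of_mem he)
  cases h with
  | deduce => exact fun ρ hρ => keep hρ
  | orient => exact fun ρ hρ => keep (.inl hρ)
  | delete => exact fun ρ hρ => keep hρ
  | simplify => exact fun ρ hρ => keep hρ
  | collapse _ _ s t t' _ hst =>
    rintro ρ (hρ | rfl)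
    · exact keep hρ
    · exact .inr (.inl ⟨t', hst, .inl (step_of_mem (.inr rfl))⟩)
  | compose _ _ s t t' _ htt =>
    rintro ρ (hρ | rfl)
    · exact keep (.inl hρ)
    · exact .inr (.inr ⟨t', step_of_mem (.inr rfl), htt.mono Set.subset_union_left⟩)

lemma StepB.simulatesEq (h : StepB B gt E R E' R') {a b : L.Term V} (hab : SymmStep E a b) :
    SimulatesEq B E' R' a b := by
  have key : ∀ {a b}, Step E a b → SimulatesEq B E' R' a b := fun h' =>
    Step.induction closedUnderContexts_simulatesEq closedUnderSubst_simulatesEq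
      h.simulatesEq_of_mem h'
  exact hab.elim key fun h' => (key h').symm

lemma StepB.simulatesRule (h : StepB B gt E R E' R') {a b : L.Term V} (hab : Step R a b) :
    SimulatesRule E' R' a b :=
  Step.induction closedUnderContexts_simulatesRule closedUnderSubst_simulatesRule
    h.simulatesRule_of_mem hab

lemma StepB.orientedBy (h : StepB B gt E R E' R') (hgt : IsReductionOrder B gt)
    (hR : OrientedBy gt R) : OrientedBy gt R' := by
  cases h with
  | deduce => exact hR
  | orient _ _ s t e _ _ hst =>
    rintro ρ (hρ | rfl)
    exacts [hR ρ hρ, hst]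
  | delete => exact hR
  | simplify => exact hR
  | collapse => exact fun ρ hρ => hR ρ (.inl hρ)
  | compose R₀ _ s t t' _ htt =>
    rintro ρ (hρ | rfl)
    · exact hR ρ (.inl hρ)
    · exact hgt.trans _ _ _ (hR (s, t) (.inr rfl))
        (hR.gt_of_step hgt (htt.mono Set.subset_union_left))

/-! ### Conversions inside a set of terms closed under descent -/

/-- Sets of terms closed under passing to smaller or `B`-equivalent terms. -/
structure IsDownset (B : Set (L.Term V × L.Term V)) (gt : L.Term V → L.Term V → Prop)
    (P : L.Term V → Prop) : Prop where
  gt : ∀ {a b}, P a → gt a b → P b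
  conv : ∀ {a b}, P a → Conv B a b → P b

lemma IsReductionOrder.isDownset (h : IsReductionOrder B gt) (w : L.Term V) :
    IsDownset B gt (gt w) :=
  ⟨h.trans _ _ _, h.gt_of_conv_right⟩

/-- Conversions with `E`, `R` and `B` all of whose terms satisfy `P`. -/
def ConvIn (P : L.Term V → Prop) (B E R : Set (L.Term V × L.Term V)) :
    L.Term V → L.Term V → Prop :=
  ReflTransGen fun a b => P a ∧ P b ∧ (SymmStep E a b ∨ SymmStep R a b ∨ SymmStep B a b)

lemma ConvIn.symm {P : L.Term V → Prop} {a b : L.Term V} (h : ConvIn P B E R a b) :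
    ConvIn P B E R b a := by
  induction h with
  | refl => exact .refl
  | tail _ h ih =>
    exact .head ⟨h.2.1, h.1, h.2.2.imp SymmStep.symm (Or.imp SymmStep.symm SymmStep.symm)⟩ ih

lemma ConvIn.mono {P Q : L.Term V → Prop} (hPQ : ∀ a, P a → Q a) {a b : L.Term V}
    (h : ConvIn P B E R a b) : ConvIn Q B E R a b :=
  ReflTransGen.mono (fun _ _ h => ⟨hPQ _ h.1, hPQ _ h.2.1, h.2.2⟩) _ _ h

lemma IsDownset.convIn_of_conv {P : L.Term V → Prop} (hP : IsDownset B gt P) {a b : L.Term V}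
    (ha : P a) (h : Conv B a b) : ConvIn P B E R a b := by
  induction h with
  | refl => exact .refl
  | tail h1 h2 ih =>
    exact .tail ih ⟨hP.conv ha h1, hP.conv ha (.tail h1 h2), .inr (.inr h2)⟩

lemma IsDownset.convIn_of_steps {P : L.Term V → Prop} (hP : IsDownset B gt P)
    (hgt : IsReductionOrder B gt) (hR : OrientedBy gt R) {a b : L.Term V}
    (ha : P a) (h : Steps R a b) : P b ∧ ConvIn P B E R a b := by
  induction h with
  | refl => exact ⟨ha, .refl⟩
  | tail h1 h2 ih =>
    have := hP.gt ih.1 (hR.gt_of_step hgt h2)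
    exact ⟨this, .tail ih.2 ⟨ih.1, this, .inr (.inl (.inl h2))⟩⟩

lemma IsDownset.convIn_of_joinableMod {P : L.Term V → Prop} (hP : IsDownset B gt P)
    (hgt : IsReductionOrder B gt) (hR : OrientedBy gt R) {a b : L.Term V}
    (ha : P a) (hb : P b) (h : JoinableMod R B a b) : ConvIn P B E R a b := by
  obtain ⟨a', b', h1, h2, h3⟩ := h
  obtain ⟨ha', h1⟩ := hP.convIn_of_steps (E := E) hgt hR ha h1
  exact (h1.trans (hP.convIn_of_conv ha' h2)).trans (hP.convIn_of_steps hgt hR hb h3).2.symm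

/-- Inference steps preserve conversions inside a downset. -/
lemma StepB.convIn (h : StepB B gt E R E' R') (hgt : IsReductionOrder B gt)
    (hR : OrientedBy gt R) {P : L.Term V → Prop} (hP : IsDownset B gt P) {a b : L.Term V}
    (hab : ConvIn P B E R a b) : ConvIn P B E' R' a b := by
  have hR' := h.orientedBy hgt hR
  have rule : ∀ {a b}, P a → P b → Step R a b → ConvIn P B E' R' a b := by
    intro a b ha hb hab
    rcases h.simulatesRule hab with h | ⟨c, h1, h2⟩ | ⟨c, h1, h2⟩
    · exact .single ⟨ha, hb, .inr (.inl (.inl h))⟩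
    · have hc := hP.gt ha (hR'.gt_of_step hgt h1)
      exact .head ⟨ha, hc, .inr (.inl (.inl h1))⟩ (.single ⟨hc, hb, .inl h2⟩)
    · have hc := hP.gt ha (hR'.gt_of_step hgt h1)
      exact .head ⟨ha, hc, .inr (.inl (.inl h1))⟩ (.single ⟨hc, hb, .inr (.inl (.inr h2))⟩)
  induction hab with
  | refl => exact .refl
  | tail _ hstep ih =>
    refine ih.trans ?_
    obtain ⟨ha, hb, hE | hR | hB⟩ := hstep
    · rcases h.simulatesEq hE with h | h | h | ⟨c, h1, h2⟩ | ⟨c, h1, h2⟩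
      · exact .single ⟨ha, hb, .inl h⟩
      · exact .single ⟨ha, hb, .inr (.inl h)⟩
      · exact hP.convIn_of_conv ha h
      · have hc := hP.gt ha (hR'.gt_of_step hgt h1)
        exact .head ⟨ha, hc, .inr (.inl (.inl h1))⟩ (.single ⟨hc, hb, .inl h2⟩)
      · have hc := hP.gt hb (hR'.gt_of_step hgt h1)
        exact .head ⟨ha, hc, .inl h2⟩ (.single ⟨hc, hb, .inr (.inl (.inr h1))⟩)
    · rcases hR with hR | hR
      exacts [rule ha hb hR, (rule hb ha hR).symm]
    · exact .single ⟨ha, hb, .inr (.inr hB)⟩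

/-- `t` is connected to `v` by one step with `E` or `R` into `P` and a conversion inside `P`. -/
def Descends (P : L.Term V → Prop) (B E R : Set (L.Term V × L.Term V)) (t v : L.Term V) : Prop :=
  ∃ c, P c ∧ (SymmStep E t c ∨ Step R t c) ∧ ConvIn P B E R c v

/-- Inference steps preserve `Descends` for terms outside `P` all of whose smaller terms belong
to `P`: orienting, simplifying, collapsing and composing can only use the step from `t`
downwards. -/
lemma StepB.descends (h : StepB B gt E R E' R') (hgt : IsReductionOrder B gt)
    (hR : OrientedBy gt R) {P : L.Term V → Prop} (hP : IsDownset B gt P) {t v : L.Term V}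
    (ht : ¬ P t) (htP : ∀ c, gt t c → P c) (htv : Descends P B E R t v) :
    Descends P B E' R' t v := by
  have hR' := h.orientedBy hgt hR
  obtain ⟨c, hc, hstep, hconv⟩ := htv
  have hconv := h.convIn hgt hR hP hconv
  rcases hstep with hE | hRt
  · rcases h.simulatesEq hE with h | (h | h) | h | ⟨d, h1, h2⟩ | ⟨d, h1, h2⟩
    · exact ⟨c, hc, .inl h, hconv⟩
    · exact ⟨c, hc, .inr h, hconv⟩
    · exact (ht (hP.gt hc (hR'.gt_of_step hgt h))).elim
    · exact (ht (hP.conv hc h.symm)).elim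
    · have hd := htP d (hR'.gt_of_step hgt h1)
      exact ⟨d, hd, .inr h1, .head ⟨hd, hc, .inl h2⟩ hconv⟩
    · have hd := hP.gt hc (hR'.gt_of_step hgt h1)
      exact ⟨d, hd, .inl h2, .head ⟨hd, hc, .inr (.inl (.inr h1))⟩ hconv⟩
  · rcases h.simulatesRule hRt with h | ⟨d, h1, h2⟩ | ⟨d, h1, h2⟩
    · exact ⟨c, hc, .inr h, hconv⟩
    · have hd := htP d (hR'.gt_of_step hgt h1)
      exact ⟨d, hd, .inr h1, .head ⟨hd, hc, .inl h2⟩ hconv⟩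
    · have hd := htP d (hR'.gt_of_step hgt h1)
      exact ⟨d, hd, .inr h1, .head ⟨hd, hc, .inr (.inl (.inr h2))⟩ hconv⟩

/-! ### Runs -/

variable {n : ℕ} {Es Rs : ℕ → Set (L.Term V × L.Term V)}

lemma IsRun.orientedBy (h : IsRun B gt E n Es Rs) (hgt : IsReductionOrder B gt) {i : ℕ}
    (hi : i ≤ n) : OrientedBy gt (Rs i) := by
  induction i with
  | zero => rw [h.init_R]; exact fun ρ hρ => hρ.elim
  | succ i ih => exact (h.step i hi).orientedBy hgt (ih (by omega))

/-- A property preserved by the inference steps passes from any stage of a run to the last. -/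
lemma IsRun.transport (h : IsRun B gt E n Es Rs)
    {Q : Set (L.Term V × L.Term V) → Set (L.Term V × L.Term V) → Prop}
    (hQ : ∀ i < n, Q (Es i) (Rs i) → Q (Es (i + 1)) (Rs (i + 1))) {i : ℕ} (hi : i ≤ n)
    (h0 : Q (Es i) (Rs i)) : Q (Es n) (Rs n) := by
  induction n, hi using Nat.le_induction with
  | base => exact h0
  | succ k hk ih =>
    exact hQ k (by omega) (ih ⟨h.init_E, h.init_R, fun j hj => h.step j (by omega)⟩
      fun j hj => hQ j (by omega))

lemma IsRun.convIn (h : IsRun B gt E n Es Rs) (hgt : IsReductionOrder B gt)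
    {P : L.Term V → Prop} (hP : IsDownset B gt P) {i : ℕ} (hi : i ≤ n) {a b : L.Term V}
    (hab : ConvIn P B (Es i) (Rs i) a b) : ConvIn P B (Es n) (Rs n) a b :=
  h.transport (Q := fun E R => ConvIn P B E R a b)
    (fun j hj hQ => (h.step j hj).convIn hgt (h.orientedBy hgt hj.le) hP hQ) hi hab

lemma IsRun.descends (h : IsRun B gt E n Es Rs) (hgt : IsReductionOrder B gt)
    {P : L.Term V → Prop} (hP : IsDownset B gt P) {i : ℕ} (hi : i ≤ n) {t v : L.Term V}
    (ht : ¬ P t) (htP : ∀ c, gt t c → P c) (htv : Descends P B (Es i) (Rs i) t v) :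
    Descends P B (Es n) (Rs n) t v :=
  h.transport (Q := fun E R => Descends P B E R t v)
    (fun j hj hQ => (h.step j hj).descends hgt (h.orientedBy hgt hj.le) hP ht htP hQ) hi htv

end

section

variable {R B E R' E' : Set (L.Term V × L.Term V)} {gt : L.Term V → L.Term V → Prop}
variable {n : ℕ} {Es Rs : ℕ → Set (L.Term V × L.Term V)}

/-! ### The presented equational theory -/

lemma Conv.mono {S S' : Set (L.Term V × L.Term V)} (h : S ⊆ S') {a b : L.Term V}
    (hab : Conv S a b) : Conv S' a b :=
  ReflTransGen.mono (fun _ _ h' => h'.imp (Step.mono h) (Step.mono h)) _ _ hab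

lemma conv_of_step_of_forall_mem {S S' : Set (L.Term V × L.Term V)}
    (h : ∀ e ∈ S, Conv S' e.1 e.2) {a b : L.Term V} (hab : Step S a b) : Conv S' a b :=
  Step.induction closedUnderContexts_conv closedUnderSubst_conv h hab

lemma conv_of_forall_mem {S S' : Set (L.Term V × L.Term V)}
    (h : ∀ e ∈ S, Conv S' e.1 e.2) {a b : L.Term V} (hab : Conv S a b) : Conv S' a b := by
  induction hab with
  | refl => exact .refl
  | tail _ h' ih =>
    refine ih.trans ?_
    exact h'.elim (conv_of_step_of_forall_mem h)
      fun h'' => (conv_of_step_of_forall_mem h h'').symm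

/-- The inference steps derive only consequences of any theory that contains `B`. -/
lemma StepB.sound (h : StepB B gt E R E' R') {T : Set (L.Term V × L.Term V)} (hB : B ⊆ T)
    (hE : ∀ e ∈ E, Conv T e.1 e.2) (hR : ∀ e ∈ R, Conv T e.1 e.2) :
    (∀ e ∈ E', Conv T e.1 e.2) ∧ ∀ e ∈ R', Conv T e.1 e.2 := by
  have hBT : ∀ {a b}, Conv B a b → Conv T a b := Conv.mono hB
  cases h with
  | deduce _ _ s m t hs ht =>
    refine ⟨?_, hR⟩
    rintro e (he | rfl)
    · exact hE e he
    · refine (conv_of_step_of_forall_mem hR hs).symm.trans ?_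
      rcases step_union.1 ht with ht | ht
      exacts [conv_of_step_of_forall_mem hR ht, hBT (conv_of_step_symmetrize ht)]
  | orient _ _ s t e he =>
    refine ⟨fun e' he' => hE e' (.inl he'), ?_⟩
    rintro ρ (hρ | rfl)
    · exact hR ρ hρ
    · have := hE e (.inr rfl)
      rcases he with rfl | rfl
      exacts [this, this.symm]
  | delete => exact ⟨fun e he => hE e (.inl he), hR⟩
  | simplify _ _ s t t' e he _ hst =>
    refine ⟨?_, hR⟩
    rintro e' (he' | rfl)
    · exact hE e' (.inl he')
    · have := hE e (.inr rfl)
      have hst := (conv_of_step_of_forall_mem hR hst).symm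
      rcases he with rfl | rfl
      exacts [hst.trans this, hst.trans this.symm]
  | collapse _ _ s t t' _ hst =>
    refine ⟨?_, fun ρ hρ => hR ρ (.inl hρ)⟩
    rintro e (he | rfl)
    · exact hE e he
    · exact (conv_of_step_of_forall_mem (fun ρ hρ => hR ρ (.inl hρ)) hst).symm.trans
        (hR (s, t) (.inr rfl))
  | compose _ _ s t t' _ htt =>
    refine ⟨hE, ?_⟩
    rintro ρ (hρ | rfl)
    · exact hR ρ (.inl hρ)
    · exact ReflTransGen.trans (hR (s, t) (.inr rfl))
        (conv_of_step_of_forall_mem (fun ρ hρ => hR ρ (.inl hρ)) htt)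

lemma IsRun.sound (h : IsRun B gt E n Es Rs) : ∀ ρ ∈ Rs n, Conv (E ∪ B) ρ.1 ρ.2 := by
  refine (h.transport (Q := fun E' R' => (∀ e ∈ E', Conv (E ∪ B) e.1 e.2) ∧
    ∀ e ∈ R', Conv (E ∪ B) e.1 e.2)
    (fun i hi hQ => (h.step i hi).sound Set.subset_union_right hQ.1 hQ.2) n.zero_le ?_).2
  rw [h.init_E, h.init_R]
  exact ⟨fun e he => .single (.inl (step_of_mem (.inl he))), fun e he => he.elim⟩

lemma not_step_empty {a b : L.Term V} : ¬ Step (∅ : Set (L.Term V × L.Term V)) a b :=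
  fun ⟨_, h, _⟩ => h

lemma not_symmStep_empty {a b : L.Term V} : ¬ SymmStep (∅ : Set (L.Term V × L.Term V)) a b :=
  fun h => h.elim not_step_empty not_step_empty

/-- The final system of a non-failing run proves all initial equations. -/
lemma IsRun.complete (h : IsRun B gt E n Es Rs) (hgt : IsReductionOrder B gt) (hn : Es n = ∅) :
    ∀ e ∈ E, Conv (Rs n ∪ B) e.1 e.2 := by
  intro e he
  have hdown : IsDownset B gt fun _ => True := ⟨fun _ _ => trivial, fun _ _ => trivial⟩
  have h0 : ConvIn (fun _ => True) B (Es 0) (Rs 0) e.1 e.2 :=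
    .single ⟨trivial, trivial, .inl (.inl (step_of_mem (by rwa [h.init_E])))⟩
  have h1 := h.convIn hgt hdown n.zero_le h0
  rw [hn] at h1
  refine ReflTransGen.mono (fun a b hab => ?_) _ _ h1
  rcases hab.2.2 with hE | hR | hB
  exacts [(not_symmStep_empty hE).elim,
    hR.imp (Step.mono Set.subset_union_left) (Step.mono Set.subset_union_left),
    hB.imp (Step.mono Set.subset_union_right) (Step.mono Set.subset_union_right)]

lemma IsRun.conv_iff (h : IsRun B gt E n Es Rs) (hgt : IsReductionOrder B gt) (hn : Es n = ∅)
    (s t : L.Term V) : Conv (E ∪ B) s t ↔ Conv (Rs n ∪ B) s t := by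
  constructor
  · refine conv_of_forall_mem ?_
    rintro e (he | he)
    exacts [h.complete hgt hn e he, .single (.inl (step_of_mem (.inr he)))]
  · refine conv_of_forall_mem ?_
    rintro e (he | he)
    exacts [h.sound e he, .single (.inl (step_of_mem (.inr he)))]

/-! ### Resolving peaks and cliffs below their source -/

lemma IsFair.of_linked (h : IsFair B n Es Rs) {a b : L.Term V} (hab : Linked (Rs n) B a b) :
    JoinableMod (Rs n) B a b ∨ ∃ i ≤ n, SymmStep (Es i) a b := by
  have key : ∀ {a b}, Step (PCP (Rs n) ∪ PCPpm (Rs n) B) a b →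
      JoinableMod (Rs n) B a b ∨ ∃ i ≤ n, SymmStep (Es i) a b := by
    refine fun h' => Step.induction (r := fun a b => JoinableMod (Rs n) B a b ∨
      ∃ i ≤ n, SymmStep (Es i) a b) ?_ ?_ h.fair h'
    · intro a b hab c p hp
      exact hab.imp (closedUnderContexts_joinableMod · c p hp)
        fun ⟨i, hi, h⟩ => ⟨i, hi, closedUnderContexts_symmStep h c p hp⟩
    · intro a b hab σ
      exact hab.imp (closedUnderSubst_joinableMod · σ)
        fun ⟨i, hi, h⟩ => ⟨i, hi, closedUnderSubst_symmStep h σ⟩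
  rcases hab with hab | hab | hab
  · exact .inl hab
  · exact key hab
  · exact (key hab).imp JoinableMod.symm fun ⟨i, hi, h⟩ => ⟨i, hi, h.symm⟩

/-- Conversions with `R` and `B` through terms smaller than `w`. -/
def ConvBelow (gt : L.Term V → L.Term V → Prop) (B R : Set (L.Term V × L.Term V))
    (w : L.Term V) : L.Term V → L.Term V → Prop := ConvIn (gt w) B ∅ R

/-- Peaks `s ← w → u` and cliffs `s ← w ∼ t` of `R` have conversions below `w`, where a cliff is
first extended by a rewrite step from `t`. -/
structure ResolvesLocally (gt : L.Term V → L.Term V → Prop) (B R : Set (L.Term V × L.Term V)) :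
    Prop where
  peak : ∀ w s u, Step R w s → Step R w u → ConvBelow gt B R w s u
  cliff : ∀ w s t, Step R w s → SymmStep B w t → ∃ u, Step R t u ∧ ConvBelow gt B R w s u

lemma IsFair.convBelow_of_linked (hfair : IsFair B n Es Rs) (h : IsRun B gt E n Es Rs)
    (hgt : IsReductionOrder B gt) (hn : Es n = ∅) {w a b : L.Term V} (ha : gt w a) (hb : gt w b)
    (hab : Linked (Rs n) B a b) : ConvBelow gt B (Rs n) w a b := by
  rcases hfair.of_linked hab with hj | ⟨i, hi, hE⟩
  · exact (hgt.isDownset w).convIn_of_joinableMod hgt (h.orientedBy hgt le_rfl) ha hb hj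
  · have := h.convIn hgt (hgt.isDownset w) hi (.single ⟨ha, hb, .inl hE⟩)
    rwa [hn] at this

lemma IsFair.resolvesLocally [Infinite V] (hfair : IsFair B n Es Rs) (h : IsRun B gt E n Es Rs)
    (hgt : IsReductionOrder B gt) (hn : Es n = ∅) : ResolvesLocally gt B (Rs n) := by
  have hor := h.orientedBy hgt le_rfl
  have hpeak : ∀ {w s t}, Step (Rs n) w s → (Step (Rs n) w t ∨ SymmStep B w t) →
      ∃ v, Step (Rs n) w v ∧ Linked (Rs n) B s v ∧ Linked (Rs n) B v t :=
    exists_linked_of_peak (hor.isTRS hgt) hfair.leftLinear (hor.variantFree hgt)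
  refine ⟨fun w s u hs hu => ?_, fun w s t hs ht => ?_⟩
  · obtain ⟨v, hv, h1, h2⟩ := hpeak hs (.inl hu)
    have hs := hor.gt_of_step hgt hs
    have hv := hor.gt_of_step hgt hv
    have hu := hor.gt_of_step hgt hu
    exact (hfair.convBelow_of_linked h hgt hn hs hv h1).trans
      (hfair.convBelow_of_linked h hgt hn hv hu h2)
  · obtain ⟨v, hv, h1, h2⟩ := hpeak hs (.inr ht)
    have hs := hor.gt_of_step hgt hs
    have hv := hor.gt_of_step hgt hv
    have hwt : Conv B w t := .single ht
    have hnot : ¬ gt w t := fun hlt => hgt.not_conv hlt hwt.symm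
    have hdown := hgt.isDownset (B := B) w
    obtain ⟨c, hc, hconv⟩ : ∃ c, Step (Rs n) t c ∧ ConvBelow gt B (Rs n) w c v := by
      rcases hfair.of_linked h2 with ⟨v', t', hvv, hc, htt⟩ | ⟨i, hi, hE⟩
      · obtain ⟨hv', hvv'⟩ := hdown.convIn_of_steps (E := ∅) hgt hor hv hvv
        have hgt' := hgt.gt_of_conv_right hv' hc
        -- The valley descends from `t`, since otherwise `t` would lie below `w`.
        rcases htt.cases_head with rfl | ⟨c, htc, hct⟩
        · exact (hnot hgt').elim
        · have hwc := hgt.gt_of_conv_left hwt (hor.gt_of_step hgt htc)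
          exact ⟨c, htc, (hdown.convIn_of_steps hgt hor hwc hct).2.trans
            (ConvIn.symm (hvv'.trans (hdown.convIn_of_conv hv' hc)))⟩
      · obtain ⟨c, hc, hstep, hconv⟩ := h.descends hgt hdown hi hnot
          (fun c hc => hgt.gt_of_conv_left hwt hc) ⟨v, hv, .inl hE.symm, .refl⟩
        rw [hn] at hstep hconv
        exact ⟨c, hstep.resolve_left not_symmStep_empty, hconv⟩
    exact ⟨c, hc, (hfair.convBelow_of_linked h hgt hn hs hv h1).trans hconv.symm⟩

/-! ### The Church–Rosser property -/

lemma ResolvesLocally.conv_step (hres : ResolvesLocally gt B R) (hgt : IsReductionOrder B gt)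
    {w s t : L.Term V} (hs : Step R w s) (hwt : Conv B w t) :
    ∃ u, Step R t u ∧ ConvBelow gt B R w s u := by
  induction hwt with
  | refl => exact ⟨s, hs, .refl⟩
  | tail hwt ht ih =>
    obtain ⟨u, hu, h1⟩ := ih
    obtain ⟨u', hu', h2⟩ := hres.cliff _ _ _ hu ht
    exact ⟨u', hu', h1.trans (h2.mono fun c hc => hgt.gt_of_conv_left hwt hc)⟩

lemma OrientedBy.exists_normalForm (hR : OrientedBy gt R) (hgt : IsReductionOrder B gt)
    (a : L.Term V) : ∃ b, Steps R a b ∧ IsNF R b := by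
  induction a using hgt.wf.induction with
  | _ a ih =>
    by_cases ha : IsNF R a
    · exact ⟨a, .refl, ha⟩
    · have : ∃ b, Step R a b := by simpa [IsNF] using ha
      obtain ⟨b, hab⟩ := this
      obtain ⟨c, hbc, hc⟩ := ih b (hR.gt_of_step hgt hab)
      exact ⟨c, hbc.head hab, hc⟩

/-- The normal forms of all terms `B`-equivalent to `a` are `B`-equivalent. -/
def UniqueNFMod (B R : Set (L.Term V × L.Term V)) (a : L.Term V) : Prop :=
  ∀ a' b b', Conv B a a' → Steps R a b → IsNF R b → Steps R a' b' → IsNF R b' → Conv B b b'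

/-- Along a conversion through terms with unique normal forms modulo `B`, the normal forms of the
two ends are equivalent. -/
lemma conv_normalForms {r : L.Term V → L.Term V → Prop}
    (hr : ∀ a b, r a b → UniqueNFMod B R a ∧ UniqueNFMod B R b ∧ (SymmStep R a b ∨ Conv B a b))
    (hnf : ∀ a, ∃ b, Steps R a b ∧ IsNF R b)
    {a b c d : L.Term V} (hab : ReflTransGen r a b) (ha : UniqueNFMod B R a)
    (hac : Steps R a c) (hc : IsNF R c) (hbd : Steps R b d) (hd : IsNF R d) : Conv B c d := by
  induction hab generalizing d with
  | refl => exact ha _ _ _ .refl hac hc hbd hd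
  | @tail x y _ hxy ih =>
    obtain ⟨e, hxe, he⟩ := hnf x
    obtain ⟨hx, hy, hxy | hxy⟩ := hr x y hxy
    · rcases hxy with hxy | hxy
      · exact ih (hbd.head hxy) hd
      · exact (ih hxe he).trans (hy _ _ _ .refl (hxe.head hxy) he hbd hd)
    · exact (ih hxe he).trans (hx _ _ _ hxy hxe he hbd hd)

lemma ResolvesLocally.uniqueNFMod (hres : ResolvesLocally gt B R) (hgt : IsReductionOrder B gt)
    (hR : OrientedBy gt R) (a : L.Term V) : UniqueNFMod B R a := by
  induction a using hgt.wf.induction with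
  | _ a ih =>
    intro a' b b' haa' hab hb hab' hb'
    rcases hab.cases_head with rfl | ⟨s, has, hsb⟩
    · rcases hab'.cases_head with rfl | ⟨s', has', hsb'⟩
      · exact haa'
      · obtain ⟨u, hu, -⟩ := hres.conv_step hgt has' haa'.symm
        exact (hb u hu).elim
    · obtain ⟨u, hu, hsu⟩ := hres.conv_step hgt has haa'
      rcases hab'.cases_head with rfl | ⟨s', has', hsb'⟩
      · exact (hb' u hu).elim
      · have hus' : ConvBelow gt B R a u s' := (hres.peak _ _ _ hu has').mono
          fun c hc => hgt.gt_of_conv_left haa' hc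
        refine conv_normalForms (fun x y hxy => ⟨ih x hxy.1, ih y hxy.2.1, ?_⟩)
          (hR.exists_normalForm hgt) (hsu.trans hus') (ih s (hR.gt_of_step hgt has))
          hsb hb hsb' hb'
        rcases hxy.2.2 with h | h | h
        exacts [(not_symmStep_empty h).elim, .inl h, .inr (.single h)]

lemma ResolvesLocally.churchRosserMod (hres : ResolvesLocally gt B R)
    (hgt : IsReductionOrder B gt) (hR : OrientedBy gt R) : ChurchRosserMod R B := by
  intro s t hst
  obtain ⟨s', hs, hs'⟩ := hR.exists_normalForm hgt s
  obtain ⟨t', ht, ht'⟩ := hR.exists_normalForm hgt t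
  have huniq := hres.uniqueNFMod hgt hR
  refine ⟨s', t', hs, ?_, ht⟩
  refine conv_normalForms (fun x y hxy => ⟨huniq x, huniq y, ?_⟩)
    (hR.exists_normalForm hgt) hst (huniq s) hs hs' ht ht'
  rcases hxy with h | h | h
  exacts [.inl (.inl h), .inl (.inr h), .inr h]

end

end RewritingModulo

theorem mainTheorem5 {L : FirstOrder.Language.{u, v}} {V : Type w} [Infinite V]
    (B : Set (L.Term V × L.Term V))
    (hB : ∀ e ∈ B, RewritingModulo.vars e.1 = RewritingModulo.vars e.2)
    (gt : L.Term V → L.Term V → Prop) (hgt : RewritingModulo.IsReductionOrder B gt)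
    (E : Set (L.Term V × L.Term V)) (n : ℕ) (Es Rs : ℕ → Set (L.Term V × L.Term V))
    (hrun : RewritingModulo.IsRun B gt E n Es Rs)
    (hfair : RewritingModulo.IsFair B n Es Rs)
    (hnonfailing : Es n = ∅) :
    RewritingModulo.IsCompletePresentation B E (Rs n) := by
  have hor := hrun.orientedBy hgt le_rfl
  exact ⟨hor.isTRS hgt, hor.terminatingMod hgt,
    (hfair.resolvesLocally hrun hgt hnonfailing).churchRosserMod hgt hor,
    hrun.conv_iff hgt hnonfailing⟩
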